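/- Let $M$ be a compact, connected smooth manifold without boundary with $H_1(M;\mathbb Z)\cong\mathbb Z^b$, $b>0$, and fix a basis $\Gamma_1,\dots,\Gamma_b$ of $H_1(M;\mathbb Z)$ and smooth closed one-forms $\omega_1,\dots,\omega_b$ on $M$ (for instance harmonic forms for a Riemannian metric) with $\omega_i(\Gamma_j)=\delta_{ij}$. Let $p:\tilde M_a\to M$ be the universal Abelian cover, i.e. the connected covering space corresponding to the commutator subgroup of $\pi_1(M)$, fix a base point $z\in\tilde M_a$, and define $\tilde\iota:\tilde M_a\to\mathbb R^b$ by $\tilde\iota_i(\tilde x)=\int_\gamma p^*\omega_i$, where $\gamma$ is any smooth path in $\tilde M_a$ from $z$ to $\tilde x$. Let $f:M\to M$ be continuous, let $\tilde f:\tilde M_a\to\tilde M_a$ be a (continuous) lift of $f$, let $A\in M_b(\mathbb Z)$ be the matrix of $f_*:H_1(M;\mathbb Z)\to H_1(M;\mathbb Z)$ in the basis $(\Gamma_j)$, and let $\Phi_A:\mathbb T^b\to\mathbb T^b$, $\mathbb T^b=\mathbb R^b/\mathbb Z^b$, be the induced toral endomorphism. Assume that $f$ is $H_1$-expanding: every complex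 eigenvalue $\mu$ of $A$ satisfies $|\mu|>1$. Then there is $\lambda$ with $\rho(A^{-1})<1/\lambda<1$ (where $\rho$ is the spectral radius), and for every such $\lambda$ there is an adapted norm, i.e. a norm $\|\cdot\|$ on $\mathbb R^b$ whose operator norm satisfies $\|A^{-1}\|<1/\lambda$. For every such $\lambda$ and every adapted norm $\|\cdot\|$, the function $\tilde\sigma(\tilde x)=\tilde\iota(\tilde f(\tilde x))-A\,\tilde\iota(\tilde x)$ is bounded on $\tilde M_a$, and with $$c(f)=\sup_{\tilde x\in\tilde M_a}\|\tilde\sigma(\tilde x)\|,\qquad \delta(f)=\frac{c(f)}{\lambda-1},$$ the following hold. 1. For every $\tilde x_0\in\tilde M_a$ there is a unique $\tilde y\in\mathbb R^b$ such that $$\|\tilde\iota(\tilde f^{\,i}(\tilde x_0))-A^i\tilde y\|\le\delta(f)\qquad\text{for all } i\ge 0 .$$ 2. Consequently, for these $\tilde x_0$ and $\tilde y$, the orbit of $p(\tilde x_0)$ under $f$ globally shadows the orbit of $\tilde y+\mathbb Z^b$ under $\Phi_A$ with constant $\delta(f)$; in particular, for every $x\in M$ the orbit of $x$ under $f$ globally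 shadows an orbit of $\Phi_A$ with constant $\delta(f)$. Here $(x,f)$ is said to globally shadow $(y,\Phi_A)$ with constant $K$ if there are lifts $\tilde x'\in\tilde M_a$ of $x$, $\tilde y'\in\mathbb R^b$ of $y$ and $\tilde f'$ of $f$ with $\|\tilde\iota(\tilde f'^{\,n}(\tilde x'))-A^n\tilde y'\|\le K$ for all $n\ge0$. -/

import Mathlib

open scoped Manifold ContDiff Simplicial
open CategoryTheory

universe u v

noncomputable section

namespace GlobalShadowing

/-! ### First integral singular homology and the class of a loop -/

/-- The coefficient group `ℤ`, in the universe of the space. -/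
abbrev coeff : ModuleCat.{u} ℤ := ModuleCat.of ℤ (ULift.{u} ℤ)

/-- `H₁(M; ℤ)`, singular homology. -/
abbrev H1 (M : Type u) [TopologicalSpace M] : ModuleCat.{u} ℤ :=
  ((AlgebraicTopology.singularHomologyFunctor (ModuleCat.{u} ℤ) 1).obj coeff).obj (TopCat.of M)

/-- The map `f_* : H₁(M; ℤ) → H₁(M; ℤ)` induced by a continuous map `f`. -/
def H1map {M : Type u} [TopologicalSpace M] (f : C(M, M)) : H1 M →ₗ[ℤ] H1 M :=
  (((AlgebraicTopology.singularHomologyFunctor (ModuleCat.{u} ℤ) 1).obj coeff).map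
    (TopCat.ofHom f)).hom

/-- A path, as a morphism from the unit interval. -/
def pathHom {M : Type u} [TopologicalSpace M] {x y : M} (γ : Path x y) :
    TopCat.I.{u} ⟶ TopCat.of M :=
  TopCat.ofHom (γ.toContinuousMap.comp ⟨ULift.down, continuous_uliftDown⟩)

/-- The singular `1`-simplex given by a path. -/
def pathSimplex {M : Type u} [TopologicalSpace M] {x y : M} (γ : Path x y) :
    TopCat.toSSet.obj (TopCat.of M) _⦋1⦌ :=
  TopCat.toSSetObj₁Equiv.symm (pathHom γ)

/-- The `1`-simplex given by a loop is a cycle. -/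
theorem loop_cycle {M : Type u} [TopologicalSpace M] {x : M} (γ : Path x x) :
    (TopCat.toSSet.obj (TopCat.of M)).ιChainComplex (R := coeff) (pathSimplex γ) ≫
      ((TopCat.toSSet.obj (TopCat.of M)).chainComplex coeff).d 1 0 = 0 := by
  have h0 : (TopCat.toSSet.obj (TopCat.of M)).δ 0 (pathSimplex γ) =
      (TopCat.toSSet.obj (TopCat.of M)).δ 1 (pathSimplex γ) := by
    unfold pathSimplex
    rw [TopCat.δ_zero_toSSetObj₁Equiv.symm, TopCat.δ_one_toSSetObj₁Equiv.symm]
    exact congrArg _ (γ.target.trans γ.source.symm)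
  rw [SSet.ιChainComplex_d, Fin.sum_univ_two, h0]
  simp

/-- The class in `H₁(M; ℤ)` of a loop. -/
def loopClass {M : Type u} [TopologicalSpace M] {x : M} (γ : Path x x) : H1 M :=
  (((TopCat.toSSet.obj (TopCat.of M)).chainComplex coeff).liftCycles
      ((TopCat.toSSet.obj (TopCat.of M)).ιChainComplex (R := coeff) (pathSimplex γ)) 0 (by simp)
      (loop_cycle γ) ≫
    ((TopCat.toSSet.obj (TopCat.of M)).chainComplex coeff).homologyπ 1).hom (ULift.up 1)

/-- The integer matrix of `f_*` in a basis `Γ` of `H₁(M; ℤ)`: `f_* Γⱼ = ∑ᵢ Aᵢⱼ Γᵢ`. -/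
def homologyMatrix {b : ℕ} {M : Type u} [TopologicalSpace M]
    (Γ : Module.Basis (Fin b) ℤ (H1 M)) (f : C(M, M)) : Matrix (Fin b) (Fin b) ℤ :=
  LinearMap.toMatrix Γ Γ (H1map f)

/-! ### One-forms and their integrals -/

/-- A one-form on an `m`-dimensional manifold: a covector at each point. -/
abbrev OneForm (m : ℕ) (M : Type u) [TopologicalSpace M]
    [ChartedSpace (EuclideanSpace ℝ (Fin m)) M] : Type u :=
  (x : M) → TangentSpace (𝓡 m) x →L[ℝ] ℝ

section Forms

variable {m : ℕ} {M : Type u} [TopologicalSpace M] [ChartedSpace (EuclideanSpace ℝ (Fin m)) M]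

/-- The coordinate expression of `η` in the chart at `x`, i.e. its pullback by the inverse chart. -/
def OneForm.inChart (η : OneForm m M) (x : M) (e : EuclideanSpace ℝ (Fin m)) :
    EuclideanSpace ℝ (Fin m) →L[ℝ] ℝ :=
  (η ((extChartAt (𝓡 m) x).symm e)).comp
    (mfderiv (𝓡 m) (𝓡 m) (extChartAt (𝓡 m) x).symm e)

/-- `η` is a smooth closed one-form: in every chart its coefficients are `C^∞` and
`dη(v, w) = D_v η(w) - D_w η(v)` vanishes. -/
structure OneForm.IsSmoothClosed (η : OneForm m M) : Prop where
  smooth : ∀ x : M, ContDiffOn ℝ ∞ (η.inChart x) (extChartAt (𝓡 m) x).target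
  closed : ∀ x : M, ∀ e ∈ (extChartAt (𝓡 m) x).target, ∀ v w : EuclideanSpace ℝ (Fin m),
    fderiv ℝ (η.inChart x) e v w = fderiv ℝ (η.inChart x) e w v

/-- The path `γ : [0, 1] → M` is smooth. -/
def IsSmoothPath (m : ℕ) {M : Type u} [TopologicalSpace M]
    [ChartedSpace (EuclideanSpace ℝ (Fin m)) M] {x y : M} (γ : Path x y) : Prop :=
  ContMDiffOn 𝓘(ℝ, ℝ) (𝓡 m) ∞ γ.extend (Set.Icc 0 1)

/-- The line integral `∫_γ η = ∫₀¹ η_{γ(t)}(γ'(t)) dt`. -/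
def OneForm.integral (η : OneForm m M) {x y : M} (γ : Path x y) : ℝ :=
  ∫ t in (0 : ℝ)..1,
    η (γ.extend t) (mfderivWithin 𝓘(ℝ, ℝ) (𝓡 m) γ.extend (Set.Icc 0 1) t (1 : ℝ))

/-- The value `η(c)` of a closed one-form on a homology class `c` is `r`: the integral of `η` over
a smooth loop representing `c` is `r`. (On a connected manifold every class is represented by a
smooth loop, and for closed `η` the integral does not depend on the loop.) -/
def OneForm.HasPeriod (η : OneForm m M) (c : H1 M) (r : ℝ) : Prop :=
  ∃ (x : M) (γ : Path x x), IsSmoothPath m γ ∧ loopClass γ = c ∧ η.integral γ = r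

end Forms

/-! ### The universal Abelian cover, lifts, and the map to `ℝ^b` -/

/-- `p : M' → M` is the universal Abelian cover: the connected covering space corresponding to the
commutator subgroup of the fundamental group, that is, the quotient of the universal cover by the
action of the commutator subgroup. -/
structure IsUniversalAbelianCover {M' : Type v} {M : Type u} [TopologicalSpace M']
    [TopologicalSpace M] (p : C(M', M)) : Prop where
  covering : IsCoveringMap p
  surjective : Function.Surjective p
  pathConnected : PathConnectedSpace M'
  range_eq : ∀ x : M', (FundamentalGroup.map p x).range = commutator (FundamentalGroup M (p x))

/-- `F` is a lift of `f` through `p`. -/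
def IsLift {X Y : Type*} (p : X → Y) (f : Y → Y) (F : X → X) : Prop :=
  ∀ x, p (F x) = f (p x)

open Classical in
/-- The map `ι̃ : M' → ℝ^b`, `ι̃ᵢ(x) = ∫_γ η̃ᵢ`, where `η̃ᵢ = p^* ηᵢ` and `γ` is a smooth path in `M'`
from the base point `z` to `x`. As `p` is a local diffeomorphism, `γ` is smooth if and only if
`p ∘ γ` is, and `∫_γ p^* ηᵢ = ∫_{p ∘ γ} ηᵢ`. The path is chosen; for a connected covering space of
a connected manifold one always exists, so the second branch does not occur. -/
def albanese {b m : ℕ} {M' : Type v} {M : Type u} [TopologicalSpace M'] [TopologicalSpace M]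
    [ChartedSpace (EuclideanSpace ℝ (Fin m)) M] (p : C(M', M)) (η : Fin b → OneForm m M)
    (z x : M') : Fin b → ℝ :=
  if h : ∃ γ : Path z x, IsSmoothPath m (γ.map p.continuous) then
    fun i => (η i).integral (h.choose.map p.continuous)
  else 0

/-! ### Linear algebra: expanding matrices, adapted norms, toral endomorphisms -/

/-- An integer matrix acting on `ℝ^b`. -/
def act {b : ℕ} (A : Matrix (Fin b) (Fin b) ℤ) (y : Fin b → ℝ) : Fin b → ℝ :=
  (A.map (Int.cast : ℤ → ℝ)).mulVec y

/-- All (complex) eigenvalues of `A` are outside the unit circle. -/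
def IsExpanding {b : ℕ} (A : Matrix (Fin b) (Fin b) ℤ) : Prop :=
  ∀ μ : ℂ, Module.End.HasEigenvalue (Matrix.toLin' (A.map (Int.cast : ℤ → ℂ))) μ → 1 < ‖μ‖

/-- `lam` satisfies `ρ(A⁻¹) < 1 / lam < 1`. -/
def IsExpansionConstant {b : ℕ} (A : Matrix (Fin b) (Fin b) ℤ) (lam : ℝ) : Prop :=
  1 < lam ∧ spectralRadius ℂ (A.map (Int.cast : ℤ → ℂ))⁻¹ < ENNReal.ofReal (1 / lam)

/-- `N` is a norm on `ℝ^b` for which the operator norm of `A⁻¹` is less than `1 / lam`. -/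
structure IsAdaptedNorm {b : ℕ} (A : Matrix (Fin b) (Fin b) ℤ) (lam : ℝ)
    (N : Seminorm ℝ (Fin b → ℝ)) : Prop where
  definite : ∀ v, N v = 0 → v = 0
  contracting : ∃ k < 1 / lam, ∀ v, N ((A.map (Int.cast : ℤ → ℝ))⁻¹.mulVec v) ≤ k * N v

/-- The projection `ℝ^b → 𝕋^b = ℝ^b / ℤ^b`. -/
def torusProj {b : ℕ} (y : Fin b → ℝ) : Fin b → UnitAddCircle :=
  fun i => (y i : UnitAddCircle)

/-- The toral endomorphism `Φ_A`. -/
def toralEndo {b : ℕ} (A : Matrix (Fin b) (Fin b) ℤ) (y : Fin b → UnitAddCircle) :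
    Fin b → UnitAddCircle :=
  fun i => ∑ j, A i j • y j

/-- The linear map `A` is a lift of `Φ_A`. -/
theorem isLift_act {b : ℕ} (A : Matrix (Fin b) (Fin b) ℤ) :
    IsLift torusProj (toralEndo A) (act A) := by
  intro y
  funext i
  simp only [torusProj, toralEndo, act, Matrix.mulVec, dotProduct, Matrix.map_apply]
  rw [← QuotientAddGroup.mk'_apply, map_sum]
  refine Finset.sum_congr rfl fun j _ => ?_
  rw [← zsmul_eq_mul, map_zsmul]
  rfl

/-! ### Displacement error and shadowing -/

/-- `σ̃(x) = ι̃(f̃(x)) - A ι̃(x)`. -/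
def sigma {b : ℕ} {M' : Type v} (iota : M' → Fin b → ℝ) (F : M' → M')
    (A : Matrix (Fin b) (Fin b) ℤ) (x : M') : Fin b → ℝ :=
  iota (F x) - act A (iota x)

/-- `c(f) = ‖σ‖`, the supremum of `‖σ̃(x)‖`. -/
def cConst {b : ℕ} {M' : Type v} (iota : M' → Fin b → ℝ) (F : M' → M')
    (A : Matrix (Fin b) (Fin b) ℤ) (N : Seminorm ℝ (Fin b → ℝ)) : ℝ :=
  ⨆ x : M', N (sigma iota F A x)

/-- `δ(f) = c(f) / (lam - 1)`. -/
def deltaConst {b : ℕ} {M' : Type v} (iota : M' → Fin b → ℝ) (F : M' → M')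
    (A : Matrix (Fin b) (Fin b) ℤ) (N : Seminorm ℝ (Fin b → ℝ)) (lam : ℝ) : ℝ :=
  cConst iota F A N / (lam - 1)

/-- The orbits `(x, f̃)` and `(y, A)` shadow with constant `K`:
`‖ι̃(f̃ⁿ(x)) - Aⁿ y‖ ≤ K` for all `n ≥ 0`. -/
def Shadow {b : ℕ} {M' : Type v} (iota : M' → Fin b → ℝ) (F : M' → M')
    (A : Matrix (Fin b) (Fin b) ℤ) (N : Seminorm ℝ (Fin b → ℝ)) (K : ℝ)
    (x : M') (y : Fin b → ℝ) : Prop :=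
  ∀ n : ℕ, N (iota (F^[n] x) - (act A)^[n] y) ≤ K

/-- The orbits `(x, f)` and `(y, Φ)` in the bases globally shadow with constant `K`: there are
lifts of `x`, `y` and `f` that shadow. Here `Φ` is a toral map with the linear lift `A`. -/
def GloballyShadow {b : ℕ} {M' : Type v} {M : Type u} [TopologicalSpace M'] [TopologicalSpace M]
    (p : C(M', M)) (iota : M' → Fin b → ℝ) (f : C(M, M))
    (Φ : (Fin b → UnitAddCircle) → (Fin b → UnitAddCircle)) (A : Matrix (Fin b) (Fin b) ℤ)
    (N : Seminorm ℝ (Fin b → ℝ)) (K : ℝ) (x : M) (y : Fin b → UnitAddCircle) : Prop :=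
  IsLift torusProj Φ (act A) ∧
    ∃ (x' : M') (y' : Fin b → ℝ) (F : C(M', M')),
      p x' = x ∧ torusProj y' = y ∧ IsLift p f F ∧ Shadow iota F A N K x' y'

end GlobalShadowing

end

open GlobalShadowing

noncomputable section

namespace GlobalShadowing

open Topology Filter Set

/-! ### Systems of local primitives -/

/-! Write `ι` for the map to `ℝ^b` and `δ = c(f) / (lam - 1)`. Two points of a fibre of `p` are
joined by a path that projects to a loop `γ`. Between them `ι` changes by the periods of `γ`, and `ι
∘ F` by the periods of `f ∘ γ`. The forms are dual to `Γ`, so the second vector is `A` times the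
first. Hence `σ̃` descends to a continuous function on the compact `M` and is bounded
(`sigma_eq_of_apply_eq`, `bddAbove_seminorm_sigma`).

The rest is linear. Let `Aⁿ wₙ = ι(Fⁿ x)`. Since `A` expands by at least `lam`, and `δ` solves `δ +
c(f) = lam * δ`, induction on `n` gives `‖ι(x) - wₙ‖ ≤ δ` (`seminorm_iota_sub_le`). Applied along
the orbit, this makes `wₙ` Cauchy with rate `δ / lamⁿ`, and its limit shadows. Two shadowing points
differ by at most `2δ / lamⁿ` for all `n`, so they agree (`existsUnique_shadow`). Adapted norms come
from Gelfand's formula for `A⁻¹` by a weighted sum over finitely many powers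
(`exists_isAdaptedNorm`).

As `f` and `F` are only continuous, the forms must be integrated along continuous paths and paired
with singular homology. For this a closed form is replaced by its local primitives. Their germs form
a covering space of `M` (`isCoveringMap_pt`), and lifting to it gives path integrals, homotopy
invariance and a singular cocycle, hence `period` on `H1 M`. The fundamental theorem of calculus
identifies these with the smooth integrals (`OneForm.integral_eq_pathIntegral`). -/

/-- A closed topological one-form on `M`: a germ of a function `prim y` vanishing at `y`, for each
point `y`, such that `prim y` and `prim y'` differ locally by a constant for `y'` close to `y`. -/
structure LocalPrimitives (M : Type*) [TopologicalSpace M] where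
  /-- The primitive at a point. -/
  prim : M → M → ℝ
  compat : ∀ y, ∀ᶠ y' in 𝓝 y, ∀ᶠ w in 𝓝 y', prim y w = prim y y' + prim y' w

namespace LocalPrimitives

variable {M : Type*} [TopologicalSpace M] (θ : LocalPrimitives M)

/-- This is not a field of the structure: `compat` with all three points equal reads `a = a + a`. -/
theorem prim_self (y : M) : θ.prim y y = 0 := by
  have := (θ.compat y).self_of_nhds.self_of_nhds
  linarith

/-- `h` is a primitive of the pullback of `θ` by `s`. -/
def IsPrimitive {X : Type*} [TopologicalSpace X] (s : X → M) (h : X → ℝ) : Prop :=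
  ∀ x₀, ∀ᶠ x in 𝓝 x₀, h x = h x₀ + θ.prim (s x₀) (s x)

variable {θ}

theorem IsPrimitive.comp {X Y : Type*} [TopologicalSpace X] [TopologicalSpace Y] {s : X → M}
    {h : X → ℝ} (hh : θ.IsPrimitive s h) {φ : Y → X} (hφ : Continuous φ) :
    θ.IsPrimitive (s ∘ φ) (h ∘ φ) :=
  fun y₀ => (hφ.tendsto y₀).eventually (hh (φ y₀))

/-- The difference of two primitives is locally constant. This makes every integral below
independent of the chosen primitive. -/
theorem IsPrimitive.sub_eq {X : Type*} [TopologicalSpace X] [PreconnectedSpace X] {s : X → M}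
    {h k : X → ℝ} (hh : θ.IsPrimitive s h) (hk : θ.IsPrimitive s k) (x y : X) :
    h y - h x = k y - k x := by
  have : IsLocallyConstant fun x => h x - k x := by
    rw [IsLocallyConstant.iff_eventually_eq]
    intro x₀
    filter_upwards [hh x₀, hk x₀] with x h1 h2
    rw [h1, h2]; ring
  have := this.apply_eq_of_preconnectedSpace x y
  linarith

variable (θ)

/-! ### The covering space of germs of primitives -/

/-- The total space of the covering space of germs of primitives of `θ`. -/
@[ext]
structure GermSpace (θ : LocalPrimitives M) where
  /-- The point at which the germ is taken. -/
  pt : M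
  /-- The value of the primitive. -/
  val : ℝ

/-- The germs that belong to the same primitive as `e`. -/
def germExtend (e : θ.GermSpace) (w : M) : θ.GermSpace := ⟨w, e.val + θ.prim e.pt w⟩

instance : TopologicalSpace θ.GermSpace :=
  TopologicalSpace.mkOfNhds fun e => (𝓝 e.pt).map (θ.germExtend e)

/-- `compat` is exactly the neighbourhood axiom: a germ on the sheet through `e`, taken close to
`e`, generates the same sheet. -/
theorem nhds_germSpace (e : θ.GermSpace) : 𝓝 e = (𝓝 e.pt).map (θ.germExtend e) := by
  refine TopologicalSpace.nhds_mkOfNhds _ _ ?_ ?_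
  · intro e s hs
    have : ∀ᶠ w in 𝓝 e.pt, θ.germExtend e w ∈ s := hs
    have := this.self_of_nhds
    rw [germExtend, prim_self, add_zero] at this
    exact this
  · intro e s hs
    have hs : ∀ᶠ w in 𝓝 e.pt, θ.germExtend e w ∈ s := hs
    rw [eventually_map]
    change ∀ᶠ w in 𝓝 e.pt, ∀ᶠ v in 𝓝 w, θ.germExtend (θ.germExtend e w) v ∈ s
    filter_upwards [θ.compat e.pt, hs.eventually_nhds] with w h1 h2
    filter_upwards [h1, h2] with v h3 h4
    convert! h4 using 1
    simp only [germExtend, h3, add_assoc]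

theorem continuous_pt : Continuous (GermSpace.pt (θ := θ)) := by
  rw [continuous_iff_continuousAt]
  intro e
  rw [ContinuousAt, nhds_germSpace, tendsto_map'_iff]
  exact tendsto_id

theorem continuousAt_germSpace_iff {X : Type*} [TopologicalSpace X] {g : X → θ.GermSpace} {x : X} :
    ContinuousAt g x ↔ ContinuousAt (fun y => (g y).pt) x ∧
      ∀ᶠ y in 𝓝 x, (g y).val = (g x).val + θ.prim (g x).pt (g y).pt := by
  constructor
  · intro h
    refine ⟨θ.continuous_pt.continuousAt.comp h, ?_⟩
    rw [ContinuousAt, nhds_germSpace] at h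
    refine h.eventually (p := fun e => e.val = (g x).val + θ.prim (g x).pt e.pt) ?_
    exact eventually_map.2 (Eventually.of_forall fun _ => rfl)
  · rintro ⟨h1, h2⟩
    rw [ContinuousAt, nhds_germSpace]
    refine (Tendsto.congr' ?_ (tendsto_map.comp h1))
    filter_upwards [h2] with y hy
    exact GermSpace.ext rfl hy.symm

/-- The reals, as a discrete space. -/
@[ext]
structure DiscreteReal where
  /-- The underlying real number. -/
  val : ℝ

instance : TopologicalSpace DiscreteReal := ⊥
instance : DiscreteTopology DiscreteReal := ⟨rfl⟩

/-- The trivialization of the space of germs of primitives over a set on which `θ.prim y` is a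
primitive. -/
def germHomeomorph (y : M) (U : Set M)
    (hU : ∀ w ∈ U, ∀ᶠ v in 𝓝 w, θ.prim y v = θ.prim y w + θ.prim w v) :
    (GermSpace.pt (θ := θ)) ⁻¹' U ≃ₜ U × DiscreteReal where
  toFun e := (⟨e.1.pt, e.2⟩, ⟨e.1.val - θ.prim y e.1.pt⟩)
  invFun a := ⟨⟨a.1, a.2.val + θ.prim y a.1⟩, a.1.2⟩
  left_inv e := by
    apply Subtype.ext
    exact GermSpace.ext rfl (sub_add_cancel _ _)
  right_inv a := by
    exact Prod.ext rfl (DiscreteReal.ext (add_sub_cancel_right _ _))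
  continuous_toFun := by
    refine Continuous.prodMk
      ((θ.continuous_pt.comp continuous_subtype_val).subtype_mk _) ?_
    rw [continuous_iff_continuousAt]
    intro e
    rw [ContinuousAt, nhds_discrete DiscreteReal, tendsto_pure]
    have h1 := (θ.continuousAt_germSpace_iff (g := Subtype.val) (x := e)).1
      continuous_subtype_val.continuousAt
    filter_upwards [h1.2, h1.1.eventually (hU _ e.2)] with a ha hb
    apply DiscreteReal.ext
    dsimp only
    rw [hb, ha]
    ring
  continuous_invFun := by
    refine Continuous.subtype_mk ?_ _
    rw [continuous_iff_continuousAt]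
    intro a
    have hc : ContinuousAt (fun a : U × DiscreteReal => (a.1 : M)) a :=
      (continuous_subtype_val.comp continuous_fst).continuousAt
    rw [continuousAt_germSpace_iff]
    refine ⟨hc, ?_⟩
    have h2 : ∀ᶠ a' in 𝓝 a, a'.2 = a.2 := by
      have := (continuous_snd (X := U) (Y := DiscreteReal)).continuousAt (x := a)
      rw [ContinuousAt, nhds_discrete DiscreteReal, tendsto_pure] at this
      exact this
    filter_upwards [h2, hc.eventually (hU _ a.1.2)] with a' h3 h4
    rw [h3, h4, add_assoc]

/-- On the interior of the set provided by `compat`, `θ.prim y` is a primitive; subtracting it from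
the value of a germ gives a locally constant coordinate, so the fibre is `ℝ` with the discrete
topology. -/
theorem isCoveringMap_pt : IsCoveringMap (GermSpace.pt (θ := θ)) := by
  intro y
  refine IsEvenlyCovered.to_isEvenlyCovered_preimage (I := DiscreteReal) ?_
  have hU : ∀ w ∈ interior {w | ∀ᶠ v in 𝓝 w, θ.prim y v = θ.prim y w + θ.prim w v},
      ∀ᶠ v in 𝓝 w, θ.prim y v = θ.prim y w + θ.prim w v := by
    intro w hw
    have := interior_subset hw
    exact this
  exact ⟨inferInstance, _, mem_interior_iff_mem_nhds.2 (θ.compat y), isOpen_interior,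
    isOpen_interior.preimage θ.continuous_pt, θ.germHomeomorph y _ hU, fun e => rfl⟩

/-- The dictionary on which the construction rests: lifts of `s` to the germ space are primitives of
the pullback of `θ`, so lifting theorems become existence theorems. -/
theorem continuous_germSpace_iff {X : Type*} [TopologicalSpace X] {s : X → M} (hs : Continuous s)
    {g : X → θ.GermSpace} (hg : GermSpace.pt ∘ g = s) :
    Continuous g ↔ θ.IsPrimitive s fun x => (g x).val := by
  subst hg
  rw [continuous_iff_continuousAt]
  refine forall_congr' fun x => ?_
  rw [continuousAt_germSpace_iff]
  exact and_iff_right hs.continuousAt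

theorem exists_isPrimitive {X : Type*} [TopologicalSpace X] [SimplyConnectedSpace X]
    [LocallyPathConnectedSpace X] (s : C(X, M)) : ∃ h, θ.IsPrimitive s h := by
  obtain ⟨x₀⟩ : Nonempty X := inferInstance
  obtain ⟨g, ⟨-, hg⟩, -⟩ := θ.isCoveringMap_pt.existsUnique_continuousMap_lifts s
    (a₀ := x₀) (e₀ := ⟨s x₀, 0⟩) rfl
  exact ⟨_, (θ.continuous_germSpace_iff s.continuous hg).1 g.continuous⟩

theorem exists_isPrimitive_path {x y : M} (γ : Path x y) : ∃ h, θ.IsPrimitive γ h := by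
  obtain ⟨g, hg, -⟩ := θ.isCoveringMap_pt.exists_path_lifts γ ⟨x, 0⟩ γ.source
  exact ⟨_, (θ.continuous_germSpace_iff γ.continuous hg).1 g.continuous⟩

/-! ### Integrals along paths -/

/-- The integral of a closed topological one-form along a path. -/
def pathIntegral {x y : M} (γ : Path x y) : ℝ :=
  (θ.exists_isPrimitive_path γ).choose 1 - (θ.exists_isPrimitive_path γ).choose 0

variable {θ} in
theorem IsPrimitive.pathIntegral_eq {x y : M} {γ : Path x y} {h : unitInterval → ℝ}
    (hh : θ.IsPrimitive γ h) : θ.pathIntegral γ = h 1 - h 0 :=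
  (θ.exists_isPrimitive_path γ).choose_spec.sub_eq hh 0 1

theorem pathIntegral_trans {x y z : M} (γ : Path x y) (γ' : Path y z) :
    θ.pathIntegral (γ.trans γ') = θ.pathIntegral γ + θ.pathIntegral γ' := by
  obtain ⟨k, hk⟩ := θ.exists_isPrimitive_path (γ.trans γ')
  -- A primitive along the concatenation restricts to one along each half; the clamped maps `a` and
  -- `b` parametrize the two halves.
  let half : ℝ → unitInterval := Set.projIcc 0 1 zero_le_one
  have hc : Continuous half := continuous_projIcc
  let a : unitInterval → unitInterval := fun t => half (t / 2)
  let b : unitInterval → unitInterval := fun t => half ((t + 1) / 2)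
  have ha : Continuous a := hc.comp (by fun_prop)
  have hb : Continuous b := hc.comp (by fun_prop)
  have ea : (γ.trans γ') ∘ a = γ := by
    funext t
    have h0 : (0 : ℝ) ≤ t := t.2.1
    have h1 : (t : ℝ) ≤ 1 := t.2.2
    have : a t = ⟨t / 2, by constructor <;> linarith⟩ := Set.projIcc_of_mem _ _
    rw [Function.comp_apply, this, Path.trans_apply, dif_pos (by dsimp only; linarith)]
    congr 1
    ext
    dsimp only
    ring
  have eb : (γ.trans γ') ∘ b = γ' := by
    funext t
    have h0 : (0 : ℝ) ≤ t := t.2.1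
    have h1 : (t : ℝ) ≤ 1 := t.2.2
    have : b t = ⟨(t + 1) / 2, by constructor <;> linarith⟩ := Set.projIcc_of_mem _ _
    rw [Function.comp_apply, this, Path.trans_apply]
    split_ifs with h
    · dsimp only at h
      have : t = 0 := by ext; dsimp; linarith
      subst this
      rw [γ'.source]
      convert! γ.target
      norm_num
    · congr 1
      ext
      dsimp only
      ring
  have h1 : θ.IsPrimitive γ (k ∘ a) := ea ▸ hk.comp ha
  have h2 : θ.IsPrimitive γ' (k ∘ b) := eb ▸ hk.comp hb
  rw [hk.pathIntegral_eq, h1.pathIntegral_eq, h2.pathIntegral_eq]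
  have e0 : a 0 = 0 := by simp [a, half]
  have e1 : b 1 = 1 := by simp [b, half]
  have e2 : a 1 = b 0 := by simp [a, b]
  simp only [Function.comp_apply, e0, e1, e2]
  ring

theorem pathIntegral_symm {x y : M} (γ : Path x y) :
    θ.pathIntegral γ.symm = -θ.pathIntegral γ := by
  obtain ⟨k, hk⟩ := θ.exists_isPrimitive_path γ
  have h1 : θ.IsPrimitive γ.symm (k ∘ unitInterval.symm) := hk.comp unitInterval.continuous_symm
  rw [hk.pathIntegral_eq, h1.pathIntegral_eq]
  simp

/-- The integral is the value at the end point of the lift starting at value `0`, and this end point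
is a homotopy invariant by monodromy. -/
theorem pathIntegral_congr {x y : M} {γ γ' : Path x y} (h : γ.Homotopic γ') :
    θ.pathIntegral γ = θ.pathIntegral γ' := by
  have cov := θ.isCoveringMap_pt
  have key : ∀ δ : Path x y,
      (cov.liftPath δ ⟨x, 0⟩ δ.source 1).val = θ.pathIntegral δ := by
    intro δ
    have hl := cov.liftPath_lifts δ ⟨x, 0⟩ δ.source
    rw [((θ.continuous_germSpace_iff δ.continuous hl).1
      (cov.liftPath δ _ δ.source).continuous).pathIntegral_eq, cov.liftPath_zero]
    exact (sub_zero _).symm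
  rw [← key, ← key]
  exact congrArg GermSpace.val (cov.liftPath_apply_one_eq_of_homotopicRel h _ _ _)

/-- The periods of `θ`, as a homomorphism from the fundamental group. -/
def periodHom (x : M) : FundamentalGroup M x →* Multiplicative ℝ where
  toFun c := Multiplicative.ofAdd
    (Quotient.lift (fun γ : Path x x => θ.pathIntegral γ) (fun _ _ h => θ.pathIntegral_congr h)
      c.toPath)
  map_one' := by
    have := θ.pathIntegral_trans (Path.refl x) (Path.refl x)
    rw [Path.refl_trans_refl] at this
    have h0 : θ.pathIntegral (Path.refl x) = 0 := by linarith
    exact congrArg Multiplicative.ofAdd h0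
  map_mul' := by
    intro a b
    induction a using Quotient.inductionOn with | _ γ
    induction b using Quotient.inductionOn with | _ γ'
    refine congrArg Multiplicative.ofAdd ?_
    -- The product in the fundamental group concatenates in the opposite order, which is harmless in
    -- a commutative target.
    exact (θ.pathIntegral_trans γ' γ).trans (add_comm _ _)

/-- In a cover whose fundamental group has image in the commutator subgroup, integrals of lifted
paths depend only on the end points. -/
theorem pathIntegral_map_eq {M' : Type*} [TopologicalSpace M'] (p : C(M', M)) {x y : M'}
    (hp : (FundamentalGroup.map p x).range ≤ commutator (FundamentalGroup M (p x)))
    (γ γ' : Path x y) :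
    θ.pathIntegral (γ.map p.continuous) = θ.pathIntegral (γ'.map p.continuous) := by
  let δ : Path x x := γ.trans γ'.symm
  have h1 : FundamentalGroup.map p x (FundamentalGroup.fromPath ⟦δ⟧) ∈
      (θ.periodHom (p x)).ker :=
    Abelianization.commutator_subset_ker _ (hp ⟨_, rfl⟩)
  have h2 : θ.pathIntegral (δ.map p.continuous) = 0 :=
    congrArg Multiplicative.toAdd (MonoidHom.mem_ker.1 h1)
  rw [Path.map_trans, ← Path.map_symm, pathIntegral_trans, pathIntegral_symm] at h2
  linarith

end LocalPrimitives

/-! ### Pairing closed topological one-forms with singular homology -/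

instance stdSimplex.simplyConnectedSpace (n : ℕ) :
    SimplyConnectedSpace (stdSimplex ℝ (Fin (n + 1))) :=
  have := (convex_stdSimplex ℝ (Fin (n + 1))).contractibleSpace
    ⟨_, single_mem_stdSimplex ℝ (0 : Fin (n + 1))⟩
  SimplyConnectedSpace.ofContractible _

theorem Convex.locallyPathConnectedSpace {E : Type*} [NormedAddCommGroup E] [NormedSpace ℝ E]
    {s : Set E} (hs : Convex ℝ s) : LocallyPathConnectedSpace s := by
  refine .of_bases (p := fun _ r => 0 < r) (s := fun x r => Metric.ball x r)
    (fun x => Metric.nhds_basis_ball) ?_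
  intro x r hr
  have h1 : IsPathConnected (Metric.ball (x : E) r ∩ s) :=
    ((convex_ball _ _).inter hs).isPathConnected ⟨x, Metric.mem_ball_self hr, x.2⟩
  have h2 : Metric.ball x r = (Subtype.val : s → E) ⁻¹' (Metric.ball (x : E) r ∩ s) := by
    ext y
    simp [Subtype.dist_eq]
  rw [h2]
  exact IsInducing.subtypeVal.isPathConnected_iff.2 (by
    rwa [Set.image_preimage_eq_of_subset]
    simp)

instance stdSimplex.locallyPathConnectedSpace (n : ℕ) :
    LocallyPathConnectedSpace (stdSimplex ℝ (Fin (n + 1))) :=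
  Convex.locallyPathConnectedSpace (convex_stdSimplex ℝ (Fin (n + 1)))

namespace LocalPrimitives

variable {M : Type u} [TopologicalSpace M] (θ : LocalPrimitives M)

/-- The integral of a closed topological one-form over a singular `1`-simplex. -/
def simplexIntegral (σ : C(stdSimplex ℝ (Fin 2), M)) : ℝ :=
  (θ.exists_isPrimitive σ).choose (stdSimplex.vertex 1) -
    (θ.exists_isPrimitive σ).choose (stdSimplex.vertex 0)

variable {θ} in
theorem IsPrimitive.simplexIntegral_eq {σ : C(stdSimplex ℝ (Fin 2), M)}
    {h : stdSimplex ℝ (Fin 2) → ℝ} (hh : θ.IsPrimitive σ h) :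
    θ.simplexIntegral σ = h (stdSimplex.vertex 1) - h (stdSimplex.vertex 0) :=
  (θ.exists_isPrimitive σ).choose_spec.sub_eq hh _ _

/-- The morphism sending `1` to `r`. -/
def realHom (r : ℝ) : coeff.{u} ⟶ ModuleCat.of ℤ (ULift.{u} ℝ) :=
  ModuleCat.ofHom ((LinearMap.toSpanSingleton ℤ (ULift.{u} ℝ) (ULift.up r)).comp
    ULift.moduleEquiv.toLinearMap)

theorem realHom_apply_one (r : ℝ) : (realHom.{u} r).hom (ULift.up 1) = ULift.up r :=
  one_smul ℤ (ULift.up.{u} r)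

theorem realHom_sub_add {r s t : ℝ} (h : r - s + t = 0) :
    realHom.{u} r - realHom.{u} s + realHom.{u} t = 0 := by
  obtain rfl : s = r + t := by linarith
  ext x
  change x.down • r - x.down • (r + t) + x.down • t = 0
  rw [smul_add]
  abel

/-- The value of the cochain of `θ` on a singular simplex. -/
def cochainValue (σ : TopCat.toSSet.obj (TopCat.of M) _⦋1⦌) : ℝ :=
  θ.simplexIntegral (TopCat.toSSetObjEquiv _ _ σ)

/-- Stokes' theorem for a closed form: a primitive `k` on the whole `2`-simplex computes all three
edges, and the differences of its vertex values cancel. -/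
theorem cochainValue_δ (τ : TopCat.toSSet.obj (TopCat.of M) _⦋2⦌) :
    θ.cochainValue ((TopCat.toSSet.obj (TopCat.of M)).δ 0 τ) -
      θ.cochainValue ((TopCat.toSSet.obj (TopCat.of M)).δ 1 τ) +
      θ.cochainValue ((TopCat.toSSet.obj (TopCat.of M)).δ 2 τ) = 0 := by
  let c : C(stdSimplex ℝ (Fin 3), M) := TopCat.toSSetObjEquiv _ _ τ
  obtain ⟨k, hk⟩ := θ.exists_isPrimitive c
  have key : ∀ i : Fin 3, θ.cochainValue ((TopCat.toSSet.obj (TopCat.of M)).δ i τ) =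
      k (stdSimplex.vertex (i.succAbove 1)) - k (stdSimplex.vertex (i.succAbove 0)) := by
    intro i
    have h1 : (TopCat.toSSetObjEquiv _ _ ((TopCat.toSSet.obj (TopCat.of M)).δ i τ) :
        stdSimplex ℝ (Fin 2) → M) = c ∘ stdSimplex.map i.succAbove := by
      funext z
      exact TopCat.toSSetObjEquiv_δ_apply τ i z
    have h2 := hk.comp (stdSimplex.continuous_map (S := ℝ) i.succAbove)
    rw [← h1] at h2
    unfold cochainValue
    refine h2.simplexIntegral_eq.trans ?_
    rw [Function.comp_apply, Function.comp_apply, stdSimplex.map_vertex, stdSimplex.map_vertex]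
  rw [key, key, key]
  simp [Fin.succAbove]

theorem cochainValue_pathSimplex {x y : M} (γ : Path x y) :
    θ.cochainValue (pathSimplex γ) = θ.pathIntegral γ := by
  obtain ⟨h, hh⟩ := θ.exists_isPrimitive_path γ
  have h1 : (TopCat.toSSetObjEquiv _ _ (pathSimplex γ) : stdSimplex ℝ (Fin 2) → M) =
      γ ∘ stdSimplexHomeomorphUnitInterval := by
    funext z
    simp [pathSimplex, TopCat.toSSetObj₁Equiv, pathHom]
    rfl
  have h2 := hh.comp stdSimplexHomeomorphUnitInterval.continuous
  rw [← h1] at h2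
  rw [hh.pathIntegral_eq]
  exact h2.simplexIntegral_eq

/-- The cochain of `θ`. -/
def cochain : ((TopCat.toSSet.obj (TopCat.of M)).chainComplex coeff.{u}).X 1 ⟶
    ModuleCat.of ℤ (ULift.{u} ℝ) :=
  Limits.Cofan.IsColimit.desc
    ((TopCat.toSSet.obj (TopCat.of M)).isColimitChainComplexXCofan coeff.{u} 1)
    fun σ => realHom (θ.cochainValue σ)

theorem ι_cochain (σ : TopCat.toSSet.obj (TopCat.of M) _⦋1⦌) :
    (TopCat.toSSet.obj (TopCat.of M)).ιChainComplex (R := coeff.{u}) σ ≫ θ.cochain =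
      realHom (θ.cochainValue σ) :=
  Limits.Cofan.IsColimit.fac _ _ _

/-- The cocycle condition, which lets `cochain` descend to homology. The simplices generate the
chains, so it is checked on each of them. -/
theorem d_cochain :
    ((TopCat.toSSet.obj (TopCat.of M)).chainComplex coeff.{u}).d 2 1 ≫ θ.cochain = 0 := by
  apply SSet.chainComplex_hom_ext
  intro τ
  rw [SSet.ιChainComplex_d_assoc, Fin.sum_univ_three, Limits.comp_zero]
  simp only [Preadditive.add_comp, Preadditive.zsmul_comp, ι_cochain]
  refine Eq.trans ?_ (realHom_sub_add (θ.cochainValue_δ τ))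
  simp [sub_eq_add_neg]

/-- The homomorphism `H₁(M; ℤ) → ℝ` of integrals of `θ`. -/
def homologyHom : ((TopCat.toSSet.obj (TopCat.of M)).chainComplex coeff.{u}).homology 1 ⟶
    ModuleCat.of ℤ (ULift.{u} ℝ) :=
  ((TopCat.toSSet.obj (TopCat.of M)).chainComplex coeff.{u}).homologyι 1 ≫
    ((TopCat.toSSet.obj (TopCat.of M)).chainComplex coeff.{u}).descOpcycles θ.cochain 2 (by simp)
      θ.d_cochain

/-- The period of `θ` on a homology class. -/
def period : H1 M →ₗ[ℤ] ℝ :=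
  ULift.moduleEquiv.toLinearMap.comp (θ.homologyHom.hom : H1 M →ₗ[ℤ] ULift.{u} ℝ)

theorem period_loopClass {x : M} (γ : Path x x) :
    θ.period (loopClass γ) = θ.pathIntegral γ := by
  have h : (((TopCat.toSSet.obj (TopCat.of M)).chainComplex coeff).liftCycles
      ((TopCat.toSSet.obj (TopCat.of M)).ιChainComplex (R := coeff) (pathSimplex γ)) 0 (by simp)
      (loop_cycle γ) ≫
    ((TopCat.toSSet.obj (TopCat.of M)).chainComplex coeff).homologyπ 1) ≫ θ.homologyHom =
      realHom (θ.pathIntegral γ) := by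
    unfold homologyHom
    rw [Category.assoc, HomologicalComplex.homology_π_ι_assoc,
      HomologicalComplex.liftCycles_i_assoc, HomologicalComplex.p_descOpcycles, ι_cochain,
      cochainValue_pathSimplex]
  have h2 := congrArg (fun φ => ULift.down (φ.hom (ULift.up 1))) h
  dsimp only at h2
  rw [realHom_apply_one] at h2
  exact h2

end LocalPrimitives

theorem H1map_loopClass {M : Type u} [TopologicalSpace M] (f : C(M, M)) {x : M} (γ : Path x x) :
    H1map f (loopClass γ) = loopClass (γ.map f.continuous) := by
  let X := TopCat.toSSet.obj (TopCat.of M)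
  let φ := SSet.chainComplexMap (TopCat.toSSet.map (TopCat.ofHom f)) coeff.{u}
  have hs : (TopCat.toSSet.map (TopCat.ofHom f)).app _ (pathSimplex γ) =
      pathSimplex (γ.map f.continuous) := by
    rfl
  have h : ((X.chainComplex coeff).liftCycles
      (X.ιChainComplex (R := coeff) (pathSimplex γ)) 0 (by simp) (loop_cycle γ) ≫
      (X.chainComplex coeff).homologyπ 1) ≫ HomologicalComplex.homologyMap φ 1 =
      (X.chainComplex coeff).liftCycles
      (X.ιChainComplex (R := coeff) (pathSimplex (γ.map f.continuous))) 0 (by simp)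
        (loop_cycle _) ≫ (X.chainComplex coeff).homologyπ 1 := by
    rw [Category.assoc, HomologicalComplex.homologyπ_naturality, ← Category.assoc]
    congr 1
    -- Cycles embed in chains, where the two sides are the simplices compared in `hs`.
    rw [← cancel_mono ((X.chainComplex coeff).iCycles 1)]
    rw [Category.assoc, HomologicalComplex.cyclesMap_i, HomologicalComplex.liftCycles_i_assoc,
      HomologicalComplex.liftCycles_i, SSet.ι_chainComplexMap_f, hs]
  exact congrArg (fun φ => φ.hom (ULift.up 1)) h

/-! ### Local primitives of closed one-forms -/

section Forms

variable {m : ℕ} {M : Type u} [TopologicalSpace M] [ChartedSpace (EuclideanSpace ℝ (Fin m)) M]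

/-- `g` is a `C¹` primitive of the one-form `η` near the point `y`. -/
def OneForm.HasPrimitiveNear (η : OneForm m M) (g : M → ℝ) (y : M) : Prop :=
  ∀ᶠ w in 𝓝 y, HasMFDerivAt (𝓡 m) 𝓘(ℝ, ℝ) g w (η w) ∧ ContMDiffAt (𝓡 m) 𝓘(ℝ, ℝ) 1 g w

/-- The integral of a closed one-form along a smooth path is the difference of the values of a
primitive. -/
theorem OneForm.integral_eq_pathIntegral {η : OneForm m M} {θ : LocalPrimitives M}
    (hθ : ∀ y, η.HasPrimitiveNear (θ.prim y) y) {x y : M} {γ : Path x y} (hγ : IsSmoothPath m γ) :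
    η.integral γ = θ.pathIntegral γ := by
  obtain ⟨h, hh⟩ := θ.exists_isPrimitive_path γ
  rw [hh.pathIntegral_eq]
  -- Clamping extends the primitive to `ℝ`, in step with `γ.extend`. It is `C¹` on `[0, 1]` with the
  -- integrand as derivative, so the fundamental theorem of calculus applies.
  let H : ℝ → ℝ := h ∘ projIcc 0 1 zero_le_one
  have hH : θ.IsPrimitive γ.extend H := hh.comp continuous_projIcc
  have hloc : ∀ t, H =ᶠ[𝓝 t] fun s => H t + (θ.prim (γ.extend t) ∘ γ.extend) s := fun t => hH t
  have hprim : ∀ t, HasMFDerivAt (𝓡 m) 𝓘(ℝ, ℝ) (θ.prim (γ.extend t)) (γ.extend t)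
      (η (γ.extend t)) ∧ ContMDiffAt (𝓡 m) 𝓘(ℝ, ℝ) 1 (θ.prim (γ.extend t)) (γ.extend t) :=
    fun t => (hθ _).self_of_nhds
  have hsm : ContDiffOn ℝ 1 H (Icc 0 1) := by
    intro t ht
    have h1 : ContMDiffWithinAt 𝓘(ℝ, ℝ) (𝓡 m) 1 γ.extend (Icc 0 1) t := (hγ t ht).of_le (by simp)
    have h2 := (hprim t).2.comp_contMDiffWithinAt t h1
    exact (contDiffWithinAt_const.add h2.contDiffWithinAt).congr_of_eventuallyEq
      ((hloc t).filter_mono nhdsWithin_le_nhds) (hloc t).self_of_nhds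
  have hder : ∀ t ∈ Icc (0 : ℝ) 1, derivWithin H (Icc 0 1) t =
      η (γ.extend t) (mfderivWithin 𝓘(ℝ, ℝ) (𝓡 m) γ.extend (Icc 0 1) t (1 : ℝ)) := by
    intro t ht
    have h1 : HasMFDerivWithinAt 𝓘(ℝ, ℝ) (𝓡 m) γ.extend (Icc 0 1) t _ :=
      ((hγ t ht).mdifferentiableWithinAt (by simp)).hasMFDerivWithinAt
    have h2 := ((hprim t).1.comp_hasMFDerivWithinAt t h1).hasFDerivWithinAt
    have h3 := (h2.const_add (H t)).congr_of_eventuallyEq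
      ((hloc t).filter_mono nhdsWithin_le_nhds) (hloc t).self_of_nhds
    have h4 := h3.hasDerivWithinAt.derivWithin (uniqueDiffOn_Icc zero_lt_one t ht)
    rw [h4]
    rfl
  unfold OneForm.integral
  have h5 := intervalIntegral.integral_derivWithin_Icc_of_contDiffOn_Icc hsm zero_le_one
  have h6 : H 1 - H 0 = h 1 - h 0 := by simp [H]
  rw [← h6, ← h5]
  refine intervalIntegral.integral_congr fun t ht => ?_
  rw [uIcc_of_le zero_le_one] at ht
  exact (hder t ht).symm

variable [IsManifold (𝓡 m) ∞ M]

theorem OneForm.inChart_comp_mfderiv (η : OneForm m M) {x w : M}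
    (hw : w ∈ (extChartAt (𝓡 m) x).source) :
    (η.inChart x (extChartAt (𝓡 m) x w)).comp (mfderiv (𝓡 m) (𝓡 m) (extChartAt (𝓡 m) x) w) =
      η w := by
  have : IsManifold (𝓡 m) 1 M := IsManifold.of_le (n := ∞) (by simp)
  have h1 := mfderivWithin_extChartAt_symm_comp_mfderiv_extChartAt' (I := 𝓡 m) hw
  rw [ModelWithCorners.range_eq_univ, mfderivWithin_univ] at h1
  -- The covectors at `w` and at its image under the chart and back have different types; they are
  -- compared on vectors of the model space.
  have h2 : ∀ w' : M, w' = w → ∀ v : EuclideanSpace ℝ (Fin m), η w' v = η w v := by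
    rintro w' rfl v; rfl
  ext v
  refine (h2 _ ((extChartAt (𝓡 m) x).left_inv hw) _).trans ?_
  exact congrArg (η w) (congrArg (fun L => L v) h1)

/-- The Poincaré lemma on a ball in the chart at `y`, pulled back to `M`. -/
theorem OneForm.IsSmoothClosed.exists_hasPrimitiveNear {η : OneForm m M} (hη : η.IsSmoothClosed)
    (y : M) : ∃ g : M → ℝ, η.HasPrimitiveNear g y := by
  have : IsManifold (𝓡 m) 1 M := IsManifold.of_le (n := ∞) (by simp)
  set φ := extChartAt (𝓡 m) y
  have hT : IsOpen φ.target := isOpen_extChartAt_target y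
  obtain ⟨r, hr, hB⟩ := Metric.isOpen_iff.1 hT (φ y) (mem_extChartAt_target y)
  have hs := (hη.smooth y).mono hB
  obtain ⟨G, hG⟩ := (convex_ball (φ y) r).exists_forall_hasFDerivAt_of_fderiv_symmetric
    Metric.isOpen_ball (hs.differentiableOn (by simp)) fun a ha v w => hη.closed y a (hB ha) v w
  have hG1 : ContDiffOn ℝ 1 G (Metric.ball (φ y) r) := by
    rw [← zero_add (1 : ℕ∞ω), contDiffOn_succ_iff_fderiv_of_isOpen Metric.isOpen_ball]
    refine ⟨fun a ha => (hG a ha).differentiableAt.differentiableWithinAt, by simp, ?_⟩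
    exact (hs.of_le (by simp)).congr fun a ha => (hG a ha).fderiv
  refine ⟨G ∘ φ, ?_⟩
  have hc : ∀ᶠ w in 𝓝 y, φ w ∈ Metric.ball (φ y) r :=
    (continuousAt_extChartAt y).eventually (Metric.ball_mem_nhds _ hr)
  filter_upwards [hc, extChartAt_source_mem_nhds (I := 𝓡 m) y] with w hw hws
  have hws' : w ∈ (chartAt (EuclideanSpace ℝ (Fin m)) y).source := by
    rwa [← extChartAt_source (I := 𝓡 m)]
  constructor
  · have h1 := (hG _ hw).hasMFDerivAt.comp w
      (mdifferentiableAt_extChartAt (I := 𝓡 m) hws').hasMFDerivAt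
    exact h1.congr_mfderiv (η.inChart_comp_mfderiv hws)
  · exact (hG1.contDiffAt (Metric.isOpen_ball.mem_nhds hw)).contMDiffAt.comp w
      (contMDiffAt_extChartAt' hws')

theorem eventually_eq_of_hasMFDerivAt_zero {d : M → ℝ} {y : M}
    (hd : ∀ᶠ w in 𝓝 y, HasMFDerivAt (𝓡 m) 𝓘(ℝ, ℝ) d w 0) : ∀ᶠ w in 𝓝 y, d w = d y := by
  have : IsManifold (𝓡 m) 1 M := IsManifold.of_le (n := ∞) (by simp)
  set φ := extChartAt (𝓡 m) y
  have hc : Tendsto φ.symm (𝓝 (φ y)) (𝓝 y) := by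
    have := continuousAt_extChartAt_symm (I := 𝓡 m) y
    rwa [ContinuousAt, extChartAt_to_inv] at this
  have h1 : ∀ᶠ e in 𝓝 (φ y), HasFDerivAt (d ∘ φ.symm) (0 : _ →L[ℝ] ℝ) e := by
    filter_upwards [hc.eventually hd, extChartAt_target_mem_nhds (I := 𝓡 m) y] with e he het
    have h2 := mdifferentiableWithinAt_extChartAt_symm (I := 𝓡 m) het
    rw [ModelWithCorners.range_eq_univ, mdifferentiableWithinAt_univ] at h2
    exact ((he.comp e h2.hasMFDerivAt).congr_mfderiv (ContinuousLinearMap.zero_comp _)).hasFDerivAt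
  obtain ⟨r, hr, hB⟩ := Metric.eventually_nhds_iff_ball.1 h1
  filter_upwards [(continuousAt_extChartAt (I := 𝓡 m) y).eventually (Metric.ball_mem_nhds _ hr),
    extChartAt_source_mem_nhds (I := 𝓡 m) y] with w hw hws
  have h3 := Metric.isOpen_ball.is_const_of_fderiv_eq_zero (𝕜 := ℝ)
    (convex_ball (φ y) r).isPreconnected
    (fun e he => (hB e he).differentiableAt.differentiableWithinAt)
    (fun e he => (hB e he).fderiv) hw (Metric.mem_ball_self hr)
  simp only [Function.comp_apply] at h3
  rwa [φ.left_inv hws, φ.left_inv (mem_extChartAt_source y)] at h3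

/-- A closed one-form has local primitives. -/
theorem OneForm.IsSmoothClosed.exists_localPrimitives {η : OneForm m M} (hη : η.IsSmoothClosed) :
    ∃ θ : LocalPrimitives M, ∀ y, η.HasPrimitiveNear (θ.prim y) y := by
  choose g hg using hη.exists_hasPrimitiveNear
  have hg' : ∀ y, η.HasPrimitiveNear (fun w => g y w - g y y) y := by
    intro y
    filter_upwards [hg y] with w hw
    refine ⟨?_, hw.2.sub contMDiffAt_const⟩
    have := hw.1.sub (hasMFDerivAt_const (I := 𝓡 m) (I' := 𝓘(ℝ, ℝ)) (g y y) w)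
    exact this.congr_mfderiv (sub_zero (η w))
  refine ⟨⟨fun y w => g y w - g y y, fun y => ?_⟩, hg'⟩
  -- For `y'` close to `y`, both primitives have derivative `η` near `y'`, so their difference is
  -- constant there.
  filter_upwards [(hg' y).eventually_nhds] with y' hy'
  have h1 : ∀ᶠ w in 𝓝 y', HasMFDerivAt (𝓡 m) 𝓘(ℝ, ℝ)
      ((fun w => g y w - g y y) - fun w => g y' w - g y' y') w 0 := by
    filter_upwards [hy', hg' y'] with w h2 h3
    exact (h2.1.sub h3.1).congr_mfderiv (sub_self (η w))
  filter_upwards [eventually_eq_of_hasMFDerivAt_zero h1] with w hw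
  simp only [Pi.sub_apply] at hw
  linarith

end Forms

/-! ### Smooth paths in a cover -/

section Cover

variable {m : ℕ} {M : Type u} [TopologicalSpace M] [ChartedSpace (EuclideanSpace ℝ (Fin m)) M]
  {M' : Type v} [TopologicalSpace M']

/-- `c` is a smooth curve in the cover, constant up to time `0` and from the time `T` on. -/
structure IsSmoothJoin (m : ℕ) {M : Type u} [TopologicalSpace M]
    [ChartedSpace (EuclideanSpace ℝ (Fin m)) M] {M' : Type v} [TopologicalSpace M'] (p : M' → M)
    (x y : M') (T : ℝ) (c : ℝ → M') : Prop where
  pos : 0 < T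
  cont : Continuous c
  smooth : ContMDiff 𝓘(ℝ, ℝ) (𝓡 m) ∞ (p ∘ c)
  left : ∀ t ≤ 0, c t = x
  right : ∀ t, T ≤ t → c t = y

theorem IsSmoothJoin.symm {p : M' → M} {x y : M'} {T : ℝ} {c : ℝ → M'}
    (h : IsSmoothJoin m p x y T c) : IsSmoothJoin m p y x T fun t => c (T - t) where
  pos := h.pos
  cont := h.cont.comp (by fun_prop)
  smooth := h.smooth.comp (g := p ∘ c) (f := fun t => T - t)
    ((contDiff_const.sub contDiff_id).contMDiff)
  left t ht := h.right _ (by linarith)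
  right t ht := h.left _ (by linarith)

/-- The pause of length `1` between the curves makes both formulas valid on the overlap `(T, T +
1)`, so smoothness is local and needs no matching of derivatives. -/
theorem IsSmoothJoin.trans {p : M' → M} {x y z : M'} {T T' : ℝ} {c c' : ℝ → M'}
    (h : IsSmoothJoin m p x y T c) (h' : IsSmoothJoin m p y z T' c') :
    ∃ d, IsSmoothJoin m p x z (T + 1 + T') d := by
  let d : ℝ → M' := fun t => if t < T + 1 then c t else c' (t - (T + 1))
  have e1 : ∀ t < T + 1, d t = c t := fun t ht => if_pos ht
  have e2 : ∀ t > T, d t = c' (t - (T + 1)) := by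
    intro t ht
    by_cases h1 : t < T + 1
    · rw [e1 t h1, h.right t ht.le, h'.left _ (by linarith)]
    · exact if_neg h1
  have f1 : ∀ t < T + 1, d =ᶠ[𝓝 t] c := fun t ht => by
    filter_upwards [gt_mem_nhds ht] with s hs using e1 s hs
  have f2 : ∀ t > T, d =ᶠ[𝓝 t] fun s => c' (s - (T + 1)) := fun t ht => by
    filter_upwards [lt_mem_nhds ht] with s hs using e2 s hs
  refine ⟨d, ?_, ?_, ?_, ?_, ?_⟩
  · linarith [h.pos, h'.pos]
  · rw [continuous_iff_continuousAt]
    intro t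
    rcases lt_or_ge t (T + 1) with ht | ht
    · exact (h.cont.continuousAt).congr (f1 t ht).symm
    · refine ContinuousAt.congr ?_ (f2 t (by linarith)).symm
      exact (h'.cont.comp (continuous_id.sub continuous_const)).continuousAt
  · intro t
    rcases lt_or_ge t (T + 1) with ht | ht
    · exact (h.smooth t).congr_of_eventuallyEq ((f1 t ht).fun_comp p)
    · refine ContMDiffAt.congr_of_eventuallyEq ?_ ((f2 t (by linarith)).fun_comp p)
      exact (h'.smooth.comp (g := p ∘ c') (f := fun t => t - (T + 1))
        ((contDiff_id.sub contDiff_const).contMDiff)) t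
  · intro t ht
    rw [e1 t (by linarith [h.pos]), h.left t ht]
  · intro t ht
    rw [e2 t (by linarith [h'.pos]), h'.right _ (by linarith)]

/-- The path traced by a smooth curve between its constant ends. -/
def IsSmoothJoin.path {p : M' → M} {x y : M'} {T : ℝ} {c : ℝ → M'}
    (h : IsSmoothJoin m p x y T c) : Path x y where
  toFun t := c (T * t)
  continuous_toFun := h.cont.comp (by fun_prop)
  source' := h.left _ (by simp)
  target' := h.right _ (by simp)

theorem IsSmoothJoin.isSmoothPath {p : C(M', M)} {x y : M'} {T : ℝ} {c : ℝ → M'}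
    (h : IsSmoothJoin m p x y T c) : IsSmoothPath m (h.path.map p.continuous) := by
  have h1 : ContMDiff 𝓘(ℝ, ℝ) (𝓡 m) ∞ fun t => p (c (T * t)) :=
    h.smooth.comp (g := p ∘ c) (f := fun t => T * t)
      ((contDiff_const.mul contDiff_id).contMDiff)
  refine h1.contMDiffOn.congr fun t ht => ?_
  rw [Path.extend_apply _ ht]
  rfl

variable [IsManifold (𝓡 m) ∞ M]

/-- A segment in a chart, reparametrized by `Real.smoothTransition` to have constant ends, is lifted
by a local inverse of `p`. Control by `U` is needed for the continuity of `albanese`. -/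
theorem eventually_exists_isSmoothJoin {p : M' → M} (hp : IsLocalHomeomorph p) (x : M')
    {U : Set M} (hU : U ∈ 𝓝 (p x)) :
    ∀ᶠ x' in 𝓝 x, ∃ c, IsSmoothJoin m p x x' 1 c ∧ ∀ t, p (c t) ∈ U := by
  obtain ⟨e, hxe, rfl⟩ := hp x
  set φ := extChartAt (𝓡 m) (e x)
  have hc : Tendsto φ.symm (𝓝 (φ (e x))) (𝓝 (e x)) := by
    have := continuousAt_extChartAt_symm (I := 𝓡 m) (e x)
    rwa [ContinuousAt, extChartAt_to_inv] at this
  have h1 : ∀ᶠ a in 𝓝 (φ (e x)), a ∈ φ.target ∧ φ.symm a ∈ e.target ∧ φ.symm a ∈ U :=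
    Filter.Eventually.and (extChartAt_target_mem_nhds (I := 𝓡 m) (e x))
      ((hc.eventually (e.open_target.mem_nhds (e.map_source hxe))).and (hc.eventually hU))
  obtain ⟨r, hr, hB⟩ := Metric.eventually_nhds_iff_ball.1 h1
  have hex : Tendsto e (𝓝 x) (𝓝 (e x)) := e.continuousAt hxe
  filter_upwards [e.open_source.mem_nhds hxe,
    hex.eventually (extChartAt_source_mem_nhds (I := 𝓡 m) (e x)),
    hex.eventually ((continuousAt_extChartAt (I := 𝓡 m) (e x)).eventually
      (Metric.ball_mem_nhds _ hr))] with x' hx' hs hb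
  let l : ℝ → EuclideanSpace ℝ (Fin m) := fun t =>
    φ (e x) + Real.smoothTransition t • (φ (e x') - φ (e x))
  have hl : ∀ t, l t ∈ Metric.ball (φ (e x)) r := fun t =>
    (convex_ball _ _).add_smul_sub_mem (Metric.mem_ball_self hr) hb
      ⟨Real.smoothTransition.nonneg t, Real.smoothTransition.le_one t⟩
  have hls : ContDiff ℝ ∞ l :=
    contDiff_const.add (Real.smoothTransition.contDiff.smul contDiff_const)
  have hpc : ∀ t, e (e.symm (φ.symm (l t))) = φ.symm (l t) := fun t =>
    e.right_inv (hB _ (hl t)).2.1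
  have hsm : ContMDiff 𝓘(ℝ, ℝ) (𝓡 m) ∞ fun t => φ.symm (l t) :=
    (contMDiffOn_extChartAt_symm (I := 𝓡 m) (n := ∞) (e x)).comp_contMDiff hls.contMDiff
      fun t => (hB _ (hl t)).1
  refine ⟨fun t => e.symm (φ.symm (l t)), ⟨one_pos, ?_, ?_, ?_, ?_⟩, fun t => ?_⟩
  · exact e.continuousOn_symm.comp_continuous hsm.continuous fun t => (hB _ (hl t)).2.1
  · convert! hsm using 1
    exact funext hpc
  · intro t ht
    have : l t = φ (e x) := by simp [l, Real.smoothTransition.zero_of_nonpos ht]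
    rw [this, φ.left_inv (mem_extChartAt_source _), e.left_inv hxe]
  · intro t ht
    have : l t = φ (e x') := by simp [l, Real.smoothTransition.one_of_one_le ht]
    rw [this, φ.left_inv hs, e.left_inv hx']
  · rw [hpc]
    exact (hB _ (hl t)).2.2

/-- Being smoothly joined is symmetric and transitive and holds for all points near a given one, so
a connected space has a single class. -/
theorem exists_isSmoothPath [PreconnectedSpace M'] {p : C(M', M)} (hp : IsLocalHomeomorph p)
    (x y : M') : ∃ γ : Path x y, IsSmoothPath m (γ.map p.continuous) := by
  obtain ⟨T, c, h⟩ : ∃ T c, IsSmoothJoin m p x y T c := by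
    refine PreconnectedSpace.induction₂' (fun x y => ∃ T c, IsSmoothJoin m p x y T c)
      (fun x => ?_) ⟨?_⟩ x y
    · filter_upwards [eventually_exists_isSmoothJoin (m := m) hp x univ_mem] with y ⟨c, hc, _⟩
      exact ⟨⟨1, c, hc⟩, 1, _, hc.symm⟩
    · rintro x y z ⟨T, c, h⟩ ⟨T', c', h'⟩
      exact ⟨_, h.trans h'⟩
  exact ⟨h.path, h.isSmoothPath⟩

/-! ### The map to `ℝ^b` -/

variable {b : ℕ} {p : C(M', M)} {η : Fin b → OneForm m M} {θ : Fin b → LocalPrimitives M}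

/-- The difference of the values of the map to `ℝ^b` is the integral along any path. -/
theorem albanese_sub (hp : IsUniversalAbelianCover p)
    (hθ : ∀ i y, (η i).HasPrimitiveNear ((θ i).prim y) y) (z : M') {x y : M'} (γ : Path x y)
    (i : Fin b) :
    albanese p η z y i - albanese p η z x i = (θ i).pathIntegral (γ.map p.continuous) := by
  have := hp.pathConnected
  have key : ∀ x : M', ∃ δ : Path z x,
      albanese p η z x i = (θ i).pathIntegral (δ.map p.continuous) := by
    intro x
    have h := exists_isSmoothPath (m := m) hp.covering.isLocalHomeomorph z x
    refine ⟨h.choose, ?_⟩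
    rw [albanese, dif_pos h]
    exact OneForm.integral_eq_pathIntegral (hθ i) h.choose_spec
  obtain ⟨δ, hδ⟩ := key x
  obtain ⟨δ', hδ'⟩ := key y
  have h1 := (θ i).pathIntegral_map_eq p (hp.range_eq z).le δ' (δ.trans γ)
  rw [Path.map_trans, LocalPrimitives.pathIntegral_trans] at h1
  linarith

theorem LocalPrimitives.pathIntegral_eq_prim (θ : LocalPrimitives M) (y : M) :
    ∃ U ∈ 𝓝 y, ∀ {w : M} (γ : Path y w), (∀ t, γ t ∈ U) → θ.pathIntegral γ = θ.prim y w := by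
  refine ⟨_, θ.compat y, fun {w} γ hγ => ?_⟩
  have h : θ.IsPrimitive γ (θ.prim y ∘ γ) := fun t =>
    (γ.continuous.tendsto t).eventually (hγ t)
  rw [h.pathIntegral_eq]
  simp [θ.prim_self]

/-- Near `x` the `i`-th coordinate is a constant plus `(θ i).prim (p x) ∘ p`, by integrating along a
short path whose projection stays where this primitive is valid. -/
theorem continuous_albanese (hp : IsUniversalAbelianCover p)
    (hθ : ∀ i y, (η i).HasPrimitiveNear ((θ i).prim y) y) (z : M') :
    Continuous (albanese p η z) := by
  refine continuous_pi fun i => continuous_iff_continuousAt.2 fun x => ?_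
  obtain ⟨U, hU, h⟩ := (θ i).pathIntegral_eq_prim (p x)
  have h1 : ContinuousAt (fun x' => albanese p η z x i + (θ i).prim (p x) (p x')) x := by
    refine continuousAt_const.add ?_
    have h2 : ContinuousAt ((θ i).prim (p x)) (p x) :=
      ((hθ i (p x)).self_of_nhds.1).continuousAt
    exact h2.comp (f := p) p.continuous.continuousAt
  refine h1.congr ?_
  filter_upwards [eventually_exists_isSmoothJoin (m := m) hp.covering.isLocalHomeomorph x hU]
    with x' ⟨c, hc, hcU⟩
  have h3 := albanese_sub hp hθ z hc.path i
  rw [h (hc.path.map p.continuous) fun t => hcU _] at h3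
  linarith

end Cover

/-! ### Expanding matrices and adapted norms -/

section Linear

attribute [local instance] Matrix.linftyOpNormedRing Matrix.linftyOpNormedAlgebra

variable {b : ℕ} {A : Matrix (Fin b) (Fin b) ℤ}

theorem IsExpanding.det_ne_zero (hA : IsExpanding A) : A.det ≠ 0 := by
  intro h
  have h1 : (A.map (Int.cast : ℤ → ℂ)).det = 0 := by
    have := Int.cast_det (R := ℂ) A
    rw [← this, h, Int.cast_zero]
  obtain ⟨v, hv, hv0⟩ := Matrix.exists_mulVec_eq_zero_iff.2 h1
  have := hA 0 (Module.End.hasEigenvalue_of_hasEigenvector (x := v)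
    ⟨Module.End.mem_eigenspace_iff.2 (by simpa using hv0), hv⟩)
  simp at this
  linarith

theorem isUnit_det_map {R : Type*} [Field R] [CharZero R] (hA : A.det ≠ 0) :
    IsUnit (A.map (Int.cast : ℤ → R)).det := by
  have := Int.cast_det (R := R) A
  rw [← this, isUnit_iff_ne_zero]
  exact_mod_cast hA

/-- The spectral radius is attained at an eigenvalue `k` of the inverse, and `k⁻¹` is then an
eigenvalue of `A`. -/
theorem IsExpanding.spectralRadius_inv_lt_one (hb : 0 < b) (hA : IsExpanding A) :
    spectralRadius ℂ (A.map (Int.cast : ℤ → ℂ))⁻¹ < 1 := by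
  have : Nonempty (Fin b) := ⟨⟨0, hb⟩⟩
  set C := A.map (Int.cast : ℤ → ℂ)
  have hC : IsUnit C.det := isUnit_det_map hA.det_ne_zero
  obtain ⟨k, hk, hk'⟩ := spectrum.exists_nnnorm_eq_spectralRadius_of_nonempty (𝕜 := ℂ) (a := C⁻¹)
    (spectrum.nonempty _)
  rw [← hk']
  rw [← Matrix.spectrum_toLin', ← Module.End.hasEigenvalue_iff_mem_spectrum] at hk
  obtain ⟨v, hv⟩ := hk.exists_hasEigenvector
  have h1 : C⁻¹.mulVec v = k • v := by simpa using hv.apply_eq_smul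
  have h2 : v = k • C.mulVec v := by
    rw [← Matrix.mulVec_smul, ← h1, Matrix.mulVec_mulVec, Matrix.mul_nonsing_inv _ hC,
      Matrix.one_mulVec]
  have hk0 : k ≠ 0 := by
    rintro rfl
    rw [zero_smul] at h2
    exact hv.2 h2
  have h3 : C.mulVec v = k⁻¹ • v := by
    conv_rhs => rw [h2]
    rw [inv_smul_smul₀ hk0]
  have h4 := hA k⁻¹ (Module.End.hasEigenvalue_of_hasEigenvector (x := v)
    ⟨Module.End.mem_eigenspace_iff.2 (by simpa using h3), hv.2⟩)
  rw [norm_inv, one_lt_inv₀ (norm_pos_iff.2 hk0)] at h4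
  exact_mod_cast h4

theorem exists_isExpansionConstant (hb : 0 < b) (hA : IsExpanding A) :
    ∃ lam, IsExpansionConstant A lam := by
  obtain ⟨r, h1, h2⟩ := ENNReal.lt_iff_exists_real_btwn.1 (hA.spectralRadius_inv_lt_one hb)
  obtain ⟨h2, h3⟩ := h2
  have hr0 : 0 < r := by
    by_contra h
    rw [ENNReal.ofReal_of_nonpos (not_lt.1 h)] at h2
    exact not_lt_bot h2
  have hr1 : r < 1 := by
    by_contra h
    rw [← ENNReal.ofReal_one] at h3
    exact absurd ((ENNReal.ofReal_lt_ofReal_iff one_pos).1 h3) h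
  exact ⟨1 / r, one_lt_one_div hr0 hr1, by rwa [one_div_one_div]⟩

/-- Gelfand's formula is applied over `ℂ` while the adapted norm lives on `ℝ^b`; the `ℓ^∞` operator
norm does not see the extension of scalars. -/
theorem norm_map_ofReal (B : Matrix (Fin b) (Fin b) ℝ) : ‖B.map ((↑) : ℝ → ℂ)‖ = ‖B‖ := by
  simp only [Matrix.linfty_opNorm_def, Matrix.map_apply, Complex.nnnorm_real]

theorem norm_map_ofReal_pow (B : Matrix (Fin b) (Fin b) ℝ) (n : ℕ) :
    ‖B.map ((↑) : ℝ → ℂ) ^ n‖ = ‖B ^ n‖ := by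
  have h : B.map ((↑) : ℝ → ℂ) ^ n = (B ^ n).map ((↑) : ℝ → ℂ) := by
    induction n with
    | zero => exact (Matrix.map_one _ Complex.ofReal_zero Complex.ofReal_one).symm
    | succ n ih =>
      rw [pow_succ, pow_succ, ih]
      exact (Matrix.map_mul (f := Complex.ofRealHom)).symm
  rw [h, norm_map_ofReal]

theorem inv_map_complex (hA : A.det ≠ 0) :
    (A.map (Int.cast : ℤ → ℂ))⁻¹ = (A.map (Int.cast : ℤ → ℝ))⁻¹.map ((↑) : ℝ → ℂ) := by
  apply Matrix.inv_eq_right_inv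
  have h1 : A.map (Int.cast : ℤ → ℂ) = Complex.ofRealHom.mapMatrix (A.map (Int.cast : ℤ → ℝ)) := by
    ext i j
    simp
  have h2 : (A.map (Int.cast : ℤ → ℝ))⁻¹.map ((↑) : ℝ → ℂ) =
    Complex.ofRealHom.mapMatrix (A.map (Int.cast : ℤ → ℝ))⁻¹ := rfl
  rw [h1, h2, ← map_mul, Matrix.mul_nonsing_inv _ (isUnit_det_map hA), map_one]

/-- If a power of `B` has norm at most `r ^ n`, then `B` has norm at most `r` with respect to some
norm. -/
theorem exists_seminorm_mulVec_le (B : Matrix (Fin b) (Fin b) ℝ) {r : ℝ} (hr : 0 < r) {n : ℕ}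
    (hn : 0 < n) (hB : ‖B ^ n‖ ≤ r ^ n) :
    ∃ N : Seminorm ℝ (Fin b → ℝ), (∀ v, N v = 0 → v = 0) ∧ ∀ v, N (B.mulVec v) ≤ r * N v := by
  let g : ℕ → (Fin b → ℝ) → ℝ := fun i v => r⁻¹ ^ i * ‖(B ^ i).mulVec v‖
  have hg : ∀ i v, 0 ≤ g i v := fun i v => by positivity
  let N : Seminorm ℝ (Fin b → ℝ) := Seminorm.of (fun v => ∑ i ∈ Finset.range n, g i v)
    (fun v w => by
      rw [← Finset.sum_add_distrib]
      refine Finset.sum_le_sum fun i _ => ?_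
      simp only [g, Matrix.mulVec_add, ← mul_add]
      gcongr
      exact norm_add_le _ _)
    (fun a v => by
      rw [Finset.mul_sum]
      refine Finset.sum_congr rfl fun i _ => ?_
      simp only [g, Matrix.mulVec_smul, norm_smul]
      ring)
  have hN : ∀ v, N v = ∑ i ∈ Finset.range n, g i v := fun v => rfl
  refine ⟨N, fun v hv => ?_, fun v => ?_⟩
  · rw [hN, Finset.sum_eq_zero_iff_of_nonneg fun i _ => hg i v] at hv
    have := hv 0 (Finset.mem_range.2 hn)
    simpa [g] using this
  · have h1 : ∀ i, g i (B.mulVec v) = r * g (i + 1) v := by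
      intro i
      simp only [g, Matrix.mulVec_mulVec, ← pow_succ]
      have : r * r⁻¹ ^ (i + 1) = r⁻¹ ^ i := by rw [pow_succ', mul_inv_cancel_left₀ hr.ne']
      rw [← mul_assoc, this]
    -- Applying `B` shifts the sum by one index, up to the factor `r`. The hypothesis on `B ^ n`
    -- says that the term gained is at most the term lost.
    have h2 : g n v ≤ g 0 v := by
      simp only [g, pow_zero, one_mul, Matrix.one_mulVec]
      calc r⁻¹ ^ n * ‖(B ^ n).mulVec v‖ ≤ r⁻¹ ^ n * (r ^ n * ‖v‖) := by
            gcongr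
            exact (Matrix.linfty_opNorm_mulVec _ _).trans (by gcongr)
        _ = ‖v‖ := by rw [← mul_assoc, ← mul_pow, inv_mul_cancel₀ hr.ne', one_pow, one_mul]
    rw [hN, hN, Finset.sum_congr rfl fun i _ => h1 i, ← Finset.mul_sum]
    gcongr r * ?_
    have := Finset.sum_range_succ' (fun i => g i v) n
    rw [Finset.sum_range_succ] at this
    linarith

/-- For `r` strictly between the spectral radius and `1 / lam`, Gelfand's formula yields `n > 0`
with `‖B ^ n‖ ≤ r ^ n`, and `r` serves as the contraction factor. -/
theorem exists_isAdaptedNorm (hA : A.det ≠ 0) {lam : ℝ} (hlam : IsExpansionConstant A lam) :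
    ∃ N, IsAdaptedNorm A lam N := by
  set C := A.map (Int.cast : ℤ → ℂ)
  set B := (A.map (Int.cast : ℤ → ℝ))⁻¹
  obtain ⟨r, -, h1, h2⟩ := ENNReal.lt_iff_exists_real_btwn.1 hlam.2
  have hl : 0 < 1 / lam := one_div_pos.2 (one_pos.trans hlam.1)
  have hr : r < 1 / lam := (ENNReal.ofReal_lt_ofReal_iff hl).1 h2
  have hr0 : 0 < r := by
    by_contra h
    rw [ENNReal.ofReal_of_nonpos (not_lt.1 h)] at h1
    exact not_lt_bot h1
  have hG := (spectrum.pow_nnnorm_pow_one_div_tendsto_nhds_spectralRadius C⁻¹).eventually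
    (gt_mem_nhds h1)
  obtain ⟨n, h3, hn⟩ := (hG.and (eventually_gt_atTop 0)).exists
  have hn' : (0 : ℝ) < n := by exact_mod_cast hn
  have h4 : ‖B ^ n‖ ≤ r ^ n := by
    have h5 : (‖C⁻¹ ^ n‖₊ : ENNReal) ≤ ENNReal.ofReal r ^ n := by
      have := ENNReal.rpow_le_rpow h3.le hn'.le
      rwa [← ENNReal.rpow_mul, one_div, inv_mul_cancel₀ hn'.ne', ENNReal.rpow_one,
        ENNReal.rpow_natCast] at this
    have h6 : ‖C⁻¹ ^ n‖ = ‖B ^ n‖ := by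
      rw [← norm_map_ofReal_pow, ← inv_map_complex hA]
    rw [← ENNReal.ofReal_pow hr0.le, ← enorm_eq_nnnorm, ← ofReal_norm, h6] at h5
    exact (ENNReal.ofReal_le_ofReal_iff (by positivity)).1 h5
  obtain ⟨N, hN, hN'⟩ := exists_seminorm_mulVec_le B hr0 hn h4
  exact ⟨N, hN, r, hr, hN'⟩

end Linear

/-! ### Norms on `ℝ^b` -/

theorem seminorm_sum_le {E ι : Type*} [AddCommGroup E] [Module ℝ E] (N : Seminorm ℝ E)
    (s : Finset ι) (f : ι → E) : N (∑ i ∈ s, f i) ≤ ∑ i ∈ s, N (f i) := by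
  classical
  induction s using Finset.induction_on with
  | empty => simp
  | insert a s ha ih =>
    rw [Finset.sum_insert ha, Finset.sum_insert ha]
    exact (map_add_le_add N _ _).trans (by gcongr)

theorem seminorm_le_mul_norm {b : ℕ} (N : Seminorm ℝ (Fin b → ℝ)) :
    ∃ K, 0 ≤ K ∧ ∀ v, N v ≤ K * ‖v‖ := by
  refine ⟨∑ i, N (Pi.single i 1), Finset.sum_nonneg fun i _ => apply_nonneg _ _, fun v => ?_⟩
  calc N v = N (∑ i, v i • Pi.single i (1 : ℝ)) := by
        congr 1
        ext j
        simp [Finset.sum_apply, Pi.single_apply]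
    _ ≤ ∑ i, N (v i • Pi.single i (1 : ℝ)) :=
        seminorm_sum_le N _ _
    _ ≤ ∑ i, N (Pi.single i 1) * ‖v‖ := by
        refine Finset.sum_le_sum fun i _ => ?_
        rw [map_smul_eq_mul, mul_comm]
        exact mul_le_mul_of_nonneg_left (norm_le_pi_norm v i) (apply_nonneg _ _)
    _ = _ := (Finset.sum_mul _ _ _).symm

theorem continuous_seminorm {b : ℕ} (N : Seminorm ℝ (Fin b → ℝ)) : Continuous N := by
  obtain ⟨K, hK, h⟩ := seminorm_le_mul_norm N
  refine LipschitzWith.continuous (K := ⟨K, hK⟩) (LipschitzWith.of_dist_le_mul fun v w => ?_)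
  rw [Real.dist_eq, dist_eq_norm]
  exact (abs_sub_map_le_sub N v w).trans (h _)

theorem exists_norm_le_mul_seminorm {b : ℕ} (N : Seminorm ℝ (Fin b → ℝ))
    (hN : ∀ v, N v = 0 → v = 0) : ∃ K, 0 ≤ K ∧ ∀ v, ‖v‖ ≤ K * N v := by
  rcases (Metric.sphere (0 : Fin b → ℝ) 1).eq_empty_or_nonempty with hS | hS
  -- An empty unit sphere means that the space is zero. Otherwise the constant is the inverse of the
  -- minimum of `N` on the sphere.
  · refine ⟨0, le_rfl, fun v => ?_⟩
    by_contra hv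
    have hv : ‖v‖ ≠ 0 := fun h => hv (by simp [h])
    have : ‖v‖⁻¹ • v ∈ Metric.sphere (0 : Fin b → ℝ) 1 := by
      simp [norm_smul, inv_mul_cancel₀ hv]
    simp [hS] at this
  · obtain ⟨u, hu, hmin⟩ := (isCompact_sphere (0 : Fin b → ℝ) 1).exists_isMinOn hS
      (continuous_seminorm N).continuousOn
    have hu1 : ‖u‖ = 1 := by simpa using hu
    have hNu : 0 < N u := by
      refine (apply_nonneg N u).lt_of_ne' fun h => ?_
      rw [hN u h, norm_zero] at hu1
      exact zero_ne_one hu1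
    refine ⟨(N u)⁻¹, by positivity, fun v => ?_⟩
    rcases eq_or_ne v 0 with rfl | hv
    · simp
    have hv' : 0 < ‖v‖ := norm_pos_iff.2 hv
    have h1 : N u ≤ N (‖v‖⁻¹ • v) := hmin (by simp [norm_smul, inv_mul_cancel₀ hv'.ne'])
    rw [map_smul_eq_mul, norm_inv, norm_norm, ← div_eq_inv_mul, le_div_iff₀ hv'] at h1
    rwa [← div_eq_inv_mul, le_div_iff₀ hNu, mul_comm]

/-! ### Shadowing -/

section Shadowing

variable {b : ℕ} {A : Matrix (Fin b) (Fin b) ℤ} {X : Type v} {iota : X → Fin b → ℝ} {F : X → X}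
  {N : Seminorm ℝ (Fin b → ℝ)} {lam : ℝ}

theorem IsAdaptedNorm.le_act (hA : A.det ≠ 0) (hN : IsAdaptedNorm A lam N) (hlam : 0 < lam)
    (v : Fin b → ℝ) : lam * N v ≤ N (act A v) := by
  obtain ⟨k, hk, h⟩ := hN.contracting
  have h1 := h (act A v)
  rw [act, Matrix.mulVec_mulVec, Matrix.nonsing_inv_mul _ (isUnit_det_map hA),
    Matrix.one_mulVec] at h1
  have h2 : N v ≤ 1 / lam * N (act A v) :=
    h1.trans (mul_le_mul_of_nonneg_right hk.le (apply_nonneg _ _))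
  rwa [one_div, ← div_eq_inv_mul, le_div_iff₀ hlam, mul_comm] at h2

theorem act_surjective (hA : A.det ≠ 0) : Function.Surjective (act A) := fun v =>
  ⟨(A.map (Int.cast : ℤ → ℝ))⁻¹.mulVec v, by
    rw [act, Matrix.mulVec_mulVec, Matrix.mul_nonsing_inv _ (isUnit_det_map hA),
      Matrix.one_mulVec]⟩

theorem act_sub (v w : Fin b → ℝ) : act A (v - w) = act A v - act A w := Matrix.mulVec_sub _ _ _

theorem iterate_act_sub (n : ℕ) (v w : Fin b → ℝ) :
    (act A)^[n] (v - w) = (act A)^[n] v - (act A)^[n] w := by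
  induction n with
  | zero => rfl
  | succ n ih => simp only [Function.iterate_succ_apply', ih, act_sub]

theorem continuous_act : Continuous (act A) :=
  (Matrix.mulVecLin (A.map (Int.cast : ℤ → ℝ))).continuous_of_finiteDimensional

theorem IsAdaptedNorm.pow_mul_le (hA : A.det ≠ 0) (hN : IsAdaptedNorm A lam N) (hlam : 0 < lam)
    (n : ℕ) (v : Fin b → ℝ) : lam ^ n * N v ≤ N ((act A)^[n] v) := by
  induction n with
  | zero => simp
  | succ n ih =>
    rw [Function.iterate_succ_apply', pow_succ, mul_comm (lam ^ n), mul_assoc]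
    exact (mul_le_mul_of_nonneg_left ih hlam.le).trans (hN.le_act hA hlam _)

theorem deltaConst_nonneg (hlam : 1 < lam) : 0 ≤ deltaConst iota F A N lam :=
  div_nonneg (Real.iSup_nonneg fun _ => apply_nonneg _ _) (sub_nonneg.2 hlam.le)

/-- A preimage under `Aⁿ` of the image of the `n`-th point of an orbit is close to the image of its
starting point. -/
theorem seminorm_iota_sub_le (hA : A.det ≠ 0) (hN : IsAdaptedNorm A lam N) (hlam : 1 < lam)
    (hbdd : BddAbove (Set.range fun x => N (sigma iota F A x))) (n : ℕ) (x : X) (w : Fin b → ℝ)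
    (hw : (act A)^[n] w = iota (F^[n] x)) : N (iota x - w) ≤ deltaConst iota F A N lam := by
  have hl : 0 < lam := one_pos.trans hlam
  induction n generalizing x w with
  | zero =>
    rw [← show w = iota x from hw, sub_self, map_zero]
    exact deltaConst_nonneg hlam
  | succ n ih =>
    rw [Function.iterate_succ_apply, Function.iterate_succ_apply] at hw
    have h1 := ih (F x) (act A w) hw
    have h2 : N (sigma iota F A x) ≤ cConst iota F A N := le_ciSup hbdd x
    have h3 : act A (iota x - w) = (iota (F x) - act A w) - sigma iota F A x := by
      rw [act_sub, sigma]
      abel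
    have h4 := hN.le_act hA hl (iota x - w)
    rw [h3] at h4
    have h5 := h4.trans (map_sub_le_add N _ _)
    -- Thus `δ + c = lam * δ`: the choice of `δ` is what closes the induction.
    have h6 : cConst iota F A N = deltaConst iota F A N lam * (lam - 1) :=
      (div_mul_cancel₀ _ (sub_pos.2 hlam).ne').symm
    refine le_of_mul_le_mul_left ?_ hl
    linarith

/-- Global shadowing of the orbits of an expanding linear map. -/
theorem existsUnique_shadow (hA : A.det ≠ 0) (hN : IsAdaptedNorm A lam N) (hlam : 1 < lam)
    (hbdd : BddAbove (Set.range fun x => N (sigma iota F A x))) (x : X) :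
    ∃! y, Shadow iota F A N (deltaConst iota F A N lam) x y := by
  have hl : 0 < lam := one_pos.trans hlam
  set δ := deltaConst iota F A N lam
  have hpow : Tendsto (fun n : ℕ => δ / lam ^ n) atTop (𝓝 0) :=
    tendsto_const_nhds.div_atTop (tendsto_pow_atTop_atTop_of_one_lt hlam)
  obtain ⟨K, hK, hKN⟩ := exists_norm_le_mul_seminorm N hN.definite
  choose w hw using fun n : ℕ => (act_surjective hA).iterate n (iota (F^[n] x))
  have hclose : ∀ i m, N (iota (F^[i] x) - (act A)^[i] (w (i + m))) ≤ δ := by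
    intro i m
    refine seminorm_iota_sub_le hA hN hlam hbdd m _ _ ?_
    rw [← Function.iterate_add_apply, ← Function.iterate_add_apply, add_comm m i, hw]
  have hcauchy : CauchySeq w := by
    refine cauchySeq_of_le_tendsto_0' (fun n => K * (δ / lam ^ n)) (fun n k hnk => ?_) ?_
    -- `Aⁿ` carries `w n - w (n + m)` to a vector of size at most `δ`, by `hclose`, and expands by
    -- at least `lam ^ n`.
    · obtain ⟨m, rfl⟩ := Nat.exists_eq_add_of_le hnk
      rw [dist_eq_norm]
      refine (hKN _).trans (mul_le_mul_of_nonneg_left ?_ hK)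
      rw [le_div_iff₀ (pow_pos hl n), mul_comm]
      refine (hN.pow_mul_le hA hl n _).trans ?_
      rw [iterate_act_sub, hw]
      exact hclose n m
    · simpa using hpow.const_mul K
  obtain ⟨y, hy⟩ := cauchySeq_tendsto_of_complete hcauchy
  have hy0 : ∀ n, N (iota (F^[n] x) - (act A)^[n] y) ≤ δ := by
    intro i
    have h1 : Tendsto (fun m => N (iota (F^[i] x) - (act A)^[i] (w (i + m)))) atTop
        (𝓝 (N (iota (F^[i] x) - (act A)^[i] y))) := by
      refine ((continuous_seminorm N).tendsto _).comp (tendsto_const_nhds.sub ?_)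
      refine ((continuous_act.iterate i).tendsto y).comp ?_
      simpa only [add_comm i] using (tendsto_add_atTop_iff_nat i).2 hy
    exact le_of_tendsto' h1 (hclose i)
  refine ⟨y, hy0, fun y' hy' => ?_⟩
  have h2 : ∀ n : ℕ, N (y' - y) ≤ 2 * (δ / lam ^ n) := by
    intro n
    rw [← mul_div_assoc, le_div_iff₀ (pow_pos hl n), mul_comm]
    refine (hN.pow_mul_le hA hl n _).trans ?_
    have h3 : (act A)^[n] (y' - y) = (iota (F^[n] x) - (act A)^[n] y) -
        (iota (F^[n] x) - (act A)^[n] y') := by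
      rw [iterate_act_sub]
      abel
    rw [h3]
    exact (map_sub_le_add N _ _).trans (by linarith [hy0 n, hy' n])
  have h4 : N (y' - y) ≤ 0 := by
    refine ge_of_tendsto' (x := atTop) ?_ h2
    simpa using hpow.const_mul 2
  exact sub_eq_zero.1 (hN.definite _ (le_antisymm h4 (apply_nonneg _ _)))

end Shadowing

/-! ### The displacement error is bounded -/

section Displacement

variable {b m : ℕ} {M : Type u} [TopologicalSpace M]
  [ChartedSpace (EuclideanSpace ℝ (Fin m)) M]
  {M' : Type v} [TopologicalSpace M'] {p : C(M', M)} {η : Fin b → OneForm m M}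
  {θ : Fin b → LocalPrimitives M} {Γ : Module.Basis (Fin b) ℤ (H1 M)}

/-- The periods of forms dual to a basis of `H₁(M; ℤ)` are the coordinates in this basis. -/
theorem period_eq_repr (hθ : ∀ i y, (η i).HasPrimitiveNear ((θ i).prim y) y)
    (hdual : ∀ i j, (η i).HasPeriod (Γ j) (if i = j then 1 else 0)) (i : Fin b) (c : H1 M) :
    (θ i).period c = (Γ.repr c i : ℤ) := by
  have h1 : ∀ j, (θ i).period (Γ j) = if i = j then 1 else 0 := by
    intro j
    obtain ⟨x, γ, hγ, hc, hr⟩ := hdual i j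
    rw [← hc, LocalPrimitives.period_loopClass, ← OneForm.integral_eq_pathIntegral (hθ i) hγ, hr]
  have h2 : (θ i).period = (Int.castAddHom ℝ).toIntLinearMap ∘ₗ Γ.coord i := by
    refine Γ.ext fun j => ?_
    rw [h1]
    simp [Finsupp.single_apply, eq_comm]
  exact LinearMap.congr_fun h2 c

/-- The periods along the image of a loop under `f` are obtained by applying the matrix of `f_*`. -/
theorem pathIntegral_map_eq_act (hθ : ∀ i y, (η i).HasPrimitiveNear ((θ i).prim y) y)
    (hdual : ∀ i j, (η i).HasPeriod (Γ j) (if i = j then 1 else 0)) (f : C(M, M)) {x : M}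
    (γ : Path x x) :
    (fun i => (θ i).pathIntegral (γ.map f.continuous)) =
      act (homologyMatrix Γ f) fun i => (θ i).pathIntegral γ := by
  funext i
  rw [← LocalPrimitives.period_loopClass, ← H1map_loopClass, period_eq_repr hθ hdual]
  have h1 := congrFun (LinearMap.toMatrix_mulVec_repr Γ Γ (H1map f) (loopClass γ)) i
  rw [← h1]
  simp only [act, Matrix.mulVec, dotProduct, Matrix.map_apply, homologyMatrix]
  push_cast
  refine Finset.sum_congr rfl fun j _ => ?_
  rw [← LocalPrimitives.period_loopClass, period_eq_repr hθ hdual]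

/-- Needed because a path projected or mapped in two ways has end points that agree only
propositionally. -/
theorem pathIntegral_congr_fun (θ : LocalPrimitives M) {x y x' y' : M} {γ : Path x y}
    {γ' : Path x' y'} (h : ∀ t, γ t = γ' t) : θ.pathIntegral γ = θ.pathIntegral γ' := by
  obtain rfl : x = x' := by rw [← γ.source, ← γ'.source, h]
  obtain rfl : y = y' := by rw [← γ.target, ← γ'.target, h]
  obtain rfl : γ = γ' := Path.ext (funext h)
  rfl

variable [IsManifold (𝓡 m) ∞ M]

/-- The displacement error is constant on the fibres of the cover. -/
theorem sigma_eq_of_apply_eq (hp : IsUniversalAbelianCover p)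
    (hθ : ∀ i y, (η i).HasPrimitiveNear ((θ i).prim y) y)
    (hdual : ∀ i j, (η i).HasPeriod (Γ j) (if i = j then 1 else 0)) (z : M') {f : C(M, M)}
    {F : C(M', M')} (hF : IsLift p f F) {x x' : M'} (hx : p x = p x') :
    sigma (albanese p η z) F (homologyMatrix Γ f) x =
      sigma (albanese p η z) F (homologyMatrix Γ f) x' := by
  have := hp.pathConnected
  let γ : Path x x' := PathConnectedSpace.somePath x x'
  let δ : Path (p x) (p x) := (γ.map p.continuous).cast rfl hx
  have h1 : albanese p η z x' - albanese p η z x = fun i => (θ i).pathIntegral δ := by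
    funext i
    exact (albanese_sub hp hθ z γ i).trans (pathIntegral_congr_fun _ fun t => rfl)
  -- The path `F ∘ γ` projects to `f ∘ δ`, as `F` lifts `f`.
  have h2 : albanese p η z (F x') - albanese p η z (F x) =
      fun i => (θ i).pathIntegral (δ.map f.continuous) := by
    funext i
    exact (albanese_sub hp hθ z (γ.map F.continuous) i).trans
      (pathIntegral_congr_fun _ fun t => hF _)
  rw [pathIntegral_map_eq_act hθ hdual, ← h1, act_sub] at h2
  rw [sigma, sigma, sub_eq_sub_iff_sub_eq_sub, ← neg_sub, h2, neg_sub]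

/-- Being constant on fibres, the norm of `σ̃` factors through `M`; the factor is continuous since a
surjective covering map is a quotient map, and compactness of `M` bounds it. -/
theorem bddAbove_seminorm_sigma [CompactSpace M] (hp : IsUniversalAbelianCover p)
    (hη : ∀ i, (η i).IsSmoothClosed)
    (hdual : ∀ i j, (η i).HasPeriod (Γ j) (if i = j then 1 else 0)) (z : M') {f : C(M, M)}
    {F : C(M', M')} (hF : IsLift p f F) (N : Seminorm ℝ (Fin b → ℝ)) :
    BddAbove (Set.range fun x : M' =>
      N (sigma (albanese p η z) F (homologyMatrix Γ f) x)) := by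
  choose θ hθ using fun i => (hη i).exists_localPrimitives
  have hι := continuous_albanese hp hθ z
  have hc : Continuous fun x : M' => N (sigma (albanese p η z) F (homologyMatrix Γ f) x) :=
    (continuous_seminorm N).comp ((hι.comp F.continuous).sub (continuous_act.comp hι))
  let s : M → ℝ := fun y =>
    N (sigma (albanese p η z) F (homologyMatrix Γ f) (Function.surjInv hp.surjective y))
  have hs : (fun x : M' => N (sigma (albanese p η z) F (homologyMatrix Γ f) x)) = s ∘ p := by
    funext x
    exact congrArg N (sigma_eq_of_apply_eq hp hθ hdual z hF
      (Function.surjInv_eq hp.surjective (p x)).symm)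
  have hsc : Continuous s := by
    rw [(hp.covering.isQuotientMap hp.surjective).continuous_iff, ← hs]
    exact hc
  rw [hs]
  exact (isCompact_range hsc).bddAbove.mono (range_comp_subset_range _ _)

end Displacement

end GlobalShadowing

end

open GlobalShadowing

theorem mainTheorem4 {b m : ℕ} (hb : 0 < b)
    -- a compact connected smooth manifold with `H₁(M; ℤ)` free of rank `b`
    {M : Type u} [TopologicalSpace M] [T2Space M] [CompactSpace M] [ConnectedSpace M]
    [ChartedSpace (EuclideanSpace ℝ (Fin m)) M] [IsManifold (𝓡 m) ∞ M]
    (Γ : Module.Basis (Fin b) ℤ (H1 M))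
    -- closed one-forms dual to the basis
    (η : Fin b → OneForm m M) (hη : ∀ i, (η i).IsSmoothClosed)
    (hdual : ∀ i j, (η i).HasPeriod (Γ j) (if i = j then 1 else 0))
    -- the universal Abelian cover with a base point
    {M' : Type v} [TopologicalSpace M'] (p : C(M', M)) (hp : IsUniversalAbelianCover p) (z : M')
    -- an `H₁`-expanding map and a lift of it
    (f : C(M, M)) (hf : IsExpanding (homologyMatrix Γ f))
    (F : C(M', M')) (hF : IsLift p f F) :
    -- expansion constants and adapted norms exist
    (∃ lam : ℝ, IsExpansionConstant (homologyMatrix Γ f) lam) ∧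
    (∀ lam : ℝ, IsExpansionConstant (homologyMatrix Γ f) lam →
      ∃ N : Seminorm ℝ (Fin b → ℝ), IsAdaptedNorm (homologyMatrix Γ f) lam N) ∧
    -- for each choice of them, `c(f)` is finite and the shadowing statement holds
    ∀ (lam : ℝ) (N : Seminorm ℝ (Fin b → ℝ)),
      IsExpansionConstant (homologyMatrix Γ f) lam →
      IsAdaptedNorm (homologyMatrix Γ f) lam N →
        BddAbove (Set.range fun x : M' => N (sigma (albanese p η z) F (homologyMatrix Γ f) x)) ∧
        (∀ x₀ : M', ∃! y : Fin b → ℝ,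
          Shadow (albanese p η z) F (homologyMatrix Γ f) N
            (deltaConst (albanese p η z) F (homologyMatrix Γ f) N lam) x₀ y) ∧
        (∀ (x₀ : M') (y : Fin b → ℝ),
          Shadow (albanese p η z) F (homologyMatrix Γ f) N
            (deltaConst (albanese p η z) F (homologyMatrix Γ f) N lam) x₀ y →
          GloballyShadow p (albanese p η z) f (toralEndo (homologyMatrix Γ f))
            (homologyMatrix Γ f) N
            (deltaConst (albanese p η z) F (homologyMatrix Γ f) N lam) (p x₀) (torusProj y)) ∧
        (∀ x : M, ∃ y : Fin b → UnitAddCircle,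
          GloballyShadow p (albanese p η z) f (toralEndo (homologyMatrix Γ f))
            (homologyMatrix Γ f) N
            (deltaConst (albanese p η z) F (homologyMatrix Γ f) N lam) x y) := by

  have hdet := hf.det_ne_zero
  refine ⟨exists_isExpansionConstant hb hf, fun lam hlam => exists_isAdaptedNorm hdet hlam,
    fun lam N hlam hN => ?_⟩
  have hbdd := bddAbove_seminorm_sigma hp hη hdual z hF N
  have hex := fun x₀ => existsUnique_shadow hdet hN hlam.1 hbdd x₀
  refine ⟨hbdd, hex, fun x₀ y hy => ⟨isLift_act _, x₀, y, F, rfl, rfl, hF, hy⟩, fun x => ?_⟩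
  obtain ⟨x₀, rfl⟩ := hp.surjective x
  obtain ⟨y, hy, -⟩ := hex x₀
  exact ⟨torusProj y, isLift_act _, x₀, y, F, rfl, rfl, hF, hy⟩
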